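/- Let $k$ be a commutative ring and $n \in \{1,2,3,\dots\} \cup \{\infty\}$. Let $\mathcal A$ be a non-positive DG-category over $k$, i.e. $\mathcal A(X,Y)^i = 0$ for $i>0$; write $g\circ f$ for composition and $H^0(\mathcal A)$ for the homotopy category. *Definitions.* A 3-term homotopy complex $(f,g,h)$ consists of closed morphisms $f\colon X\to Y$, $g\colon Y\to Z$ of degree $0$ and a morphism $h\colon X\to Z$ of degree $-1$ with $d(h)=-g\circ f$. It is *left exact* ($f$ is the homotopy kernel of $g$) if for every object $T$ the morphism of complexes $\mathcal A(T,X)\to \mathrm{Cone}\big(g\circ -\colon\mathcal A(T,Y)\to\mathcal A(T,Z)\big)[-1]$, $x\mapsto (f\circ x,h\circ x)$, induces isomorphisms on $H^i$ for all $i\le 0$; it is *right exact* ($g$ is the homotopy cokernel of $f$) if it is left exact in $\mathcal A^{\mathrm{op}}$; it is a *homotopy short exact sequence* if it is both. A square of closed degree-$0$ morphisms $f\colon X\to Y$, $a\colon X\to X'$, $b\colon Y\to Y'$, $f'\colon X'\to Y'$ with $s\colon X\to Y'$ of degree $-1$, $d(s)=f'\circ a-b\circ f$, is *homotopy cartesian*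 if for every $T$ the morphism $\mathcal A(T,X)\to\mathrm{Cone}\big((b,-f')\colon\mathcal A(T,Y)\oplus\mathcal A(T,X')\to\mathcal A(T,Y')\big)[-1]$ given by $(f,a,s)$ induces isomorphisms on $H^i$ for $i\le 0$, and *homotopy cocartesian* if it is homotopy cartesian in $\mathcal A^{\mathrm{op}}$. $\mathcal A$ is *additive* if $H^0(\mathcal A)$ is additive, and *preabelian* if moreover every closed morphism of degree $0$ has a homotopy kernel and a homotopy cokernel. $\mathcal A$ is *$n$-truncated* if $H^i(\mathcal A(X,Y))=0$ for all $X,Y$ and all $i\le -n$ (no condition if $n=\infty$). A closed morphism $f\colon X\to Y$ of degree $0$ is an *$n$-monomorphism* if for all $T$ the map $H^i(\mathcal A(T,X))\to H^i(\mathcal A(T,Y))$ is injective for $i=-n+1$ and bijective for $i\le -n$ (every $f$ is an $\infty$-monomorphism); it is an *$n$-epimorphism* if it is an $n$-monomorphism in $\mathcal A^{\mathrm{op}}$. $\mathcal A$ is an *abelian $n$-truncated DG-category* if it is $n$-truncated and preabelian, every right exact $(f,g,h)$ with $f$ an $n$-monomorphism is a homotopy short exact sequence, and every left exact $(f,g,h)$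 with $g$ an $n$-epimorphism is a homotopy short exact sequence. An *exact DG-category* is an additive DG-category with a class $\mathcal S$ of homotopy short exact sequences, called *conflations*, closed under equivalence of 3-term homotopy complexes; a closed degree-$0$ morphism is an *inflation* (resp. *deflation*) if it occurs as $f$ (resp. $g$) in some conflation $(f,g,h)$, and it is required that (Ex0) the identity of a zero object is a deflation; (Ex1) deflations are closed under composition, and so are inflations; (Ex2) every deflation $p\colon B\to C$ has a homotopy pullback along every closed degree-$0$ morphism $C'\to C$, and homotopy pullbacks of deflations are deflations; (Ex2)' every inflation $i\colon A\to B$ has a homotopy pushout along every closed degree-$0$ morphism $A\to A'$, and homotopy pushouts of inflations are inflations. Here an equivalence $(f,g,h)\to(f',g',h')$ is a tuple $(r_1,r_2,r_3,s_1,s_2,t)$ of degrees $0,0,0,-1,-1,-2$ with $r_1,r_2,r_3$ closed and invertible in $H^0(\mathcal A)$, $d(s_1)=f'r_1-r_2f$, $d(s_2)=g'r_2-r_3g$ and $d(t)=r_3h-s_2f-g's_1-h'r_1$. **Proposition.** Let $\mathcal A$ be an abelian $n$-truncated DG-category. Then $\mathcal A$ together with the class of all homotopy short exact sequences as conflations is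 an exact DG-category. Moreover, a closed morphism of degree $0$ is an inflation if and only if it is an $n$-monomorphism, and it is a deflation if and only if it is an $n$-epimorphism. -/

import Mathlib

open CategoryTheory CategoryTheory.Limits CochainComplex CochainComplex.HomComplex

universe w v u

/-- A DG-category over the commutative ring `k`: the morphisms form cochain complexes of
`k`-modules, the (bilinear, graded) composition `comp _ g f = g ∘ f` is associative and unital and
satisfies the graded Leibniz rule `d (g ∘ f) = d g ∘ f + (-1) ^ |g| g ∘ d f`. -/
structure DGCategory (k : Type w) [CommRing k] where
  Obj : Type u
  Hom : Obj → Obj → CochainComplex (ModuleCat.{v} k) ℤ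
  id (X : Obj) : (Hom X X).X 0
  comp {X Y Z : Obj} {p q n : ℤ} (h : p + q = n) :
    (Hom Y Z).X p →ₗ[k] (Hom X Y).X q →ₗ[k] (Hom X Z).X n
  d_id (X : Obj) : (Hom X X).d 0 1 (id X) = 0
  id_comp {X Y : Obj} {p : ℤ} (f : (Hom X Y).X p) : comp (zero_add p) (id Y) f = f
  comp_id {X Y : Obj} {p : ℤ} (f : (Hom X Y).X p) : comp (add_zero p) f (id X) = f
  assoc {W X Y Z : Obj} {p q r s t n : ℤ} (hpq : p + q = s) (hqr : q + r = t)
    (hs : s + r = n) (ht : p + t = n)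
    (h : (Hom Y Z).X p) (g : (Hom X Y).X q) (f : (Hom W X).X r) :
    comp hs (comp hpq h g) f = comp ht h (comp hqr g f)
  leibniz {X Y Z : Obj} {p q n p' q' n' : ℤ} (h : p + q = n)
    (hp : p + 1 = p') (hq : q + 1 = q') (hn : n + 1 = n')
    (g : (Hom Y Z).X p) (f : (Hom X Y).X q) :
    (Hom X Z).d n n' (comp h g f) =
      comp (by omega : p' + q = n') ((Hom Y Z).d p p' g) f +
        p.negOnePow • comp (by omega : p + q' = n') g ((Hom X Y).d q q' f)

namespace DGCategory

variable {k : Type w} [CommRing k]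

lemma map_units_smul {M N : Type*} [AddCommGroup M] [AddCommGroup N] {F : Type*} [FunLike F M N]
    [AddMonoidHomClass F M N] (φ : F) (ε : ℤˣ) (x : M) : φ (ε • x) = ε • φ x := by
  rw [Units.smul_def, Units.smul_def, map_zsmul]

/-- The opposite DG-category, with composition `g ∘ᵒᵖ f = (-1) ^ (|g| |f|) f ∘ g`. -/
def op (𝒜 : DGCategory.{w, v, u} k) : DGCategory.{w, v, u} k where
  Obj := 𝒜.Obj
  Hom X Y := 𝒜.Hom Y X
  id X := 𝒜.id X
  comp {_ _ _ p q n} h := (p * q).negOnePow • (𝒜.comp (by omega : q + p = n)).flip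
  d_id X := 𝒜.d_id X
  id_comp f := by simp [𝒜.comp_id]
  comp_id f := by simp [𝒜.id_comp]
  assoc {_ _ _ _ p q r s t n} hpq hqr hs ht h g f := by
    subst hpq hqr
    simp only [LinearMap.smul_apply, LinearMap.flip_apply, map_units_smul, smul_smul]
    rw [𝒜.assoc (s := q + r) (t := p + q) (n := n) (by omega) (by omega) (by omega) (by omega),
      ← Int.negOnePow_add, ← Int.negOnePow_add]
    congr 2
    ring
  leibniz {_ _ _ p q n p' q' n'} h hp hq hn g f := by
    subst hp hq
    simp only [LinearMap.smul_apply, LinearMap.flip_apply, map_units_smul, smul_smul]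
    rw [𝒜.leibniz (by omega : q + p = n) rfl rfl hn, smul_add, smul_smul, add_comm]
    congr 2
    · rw [← Int.negOnePow_add]
      congr 1
      ring
    · rw [← Int.negOnePow_add]
      have : p + p * (q + 1) = p * q + 2 * p := by ring
      rw [this, Int.negOnePow_add, Int.negOnePow_two_mul, mul_one]

variable (𝒜 : DGCategory.{w, v, u} k)

/-- The closed morphisms of degree `0`. -/
abbrev Closed (X Y : 𝒜.Obj) : Type v :=
  LinearMap.ker ((𝒜.Hom X Y).d 0 1).hom

variable {𝒜}

lemma Closed.d_eq {X Y : 𝒜.Obj} (f : 𝒜.Closed X Y) : (𝒜.Hom X Y).d 0 1 f.1 = 0 := f.2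

variable (𝒜)

/-- The category `Z⁰(𝒜)`: same objects, closed morphisms of degree `0`. -/
structure Z0 where
  obj : 𝒜.Obj

variable {𝒜}

/-- The identity as a closed morphism. -/
def closedId (X : 𝒜.Obj) : 𝒜.Closed X X := ⟨𝒜.id X, 𝒜.d_id X⟩

/-- The composition `g ∘ f` of closed morphisms of degree `0`. -/
def closedComp {X Y Z : 𝒜.Obj} (g : 𝒜.Closed Y Z) (f : 𝒜.Closed X Y) : 𝒜.Closed X Z :=
  ⟨𝒜.comp (add_zero 0) g.1 f.1, by
    change (𝒜.Hom X Z).d 0 1 _ = 0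
    rw [𝒜.leibniz (add_zero 0) (zero_add 1) (zero_add 1) (zero_add 1), g.d_eq, f.d_eq]
    simp⟩

instance : Category (Z0 𝒜) where
  Hom X Y := 𝒜.Closed X.obj Y.obj
  id X := closedId X.obj
  comp f g := closedComp g f
  id_comp f := Subtype.ext (𝒜.comp_id f.1)
  comp_id f := Subtype.ext (𝒜.id_comp f.1)
  assoc f g h := Subtype.ext (𝒜.assoc _ _ _ _ h.1 g.1 f.1).symm

instance : Preadditive (Z0 𝒜) where
  homGroup X Y := inferInstanceAs (AddCommGroup (𝒜.Closed X.obj Y.obj))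
  add_comp _ _ _ f f' g := Subtype.ext (map_add (𝒜.comp (add_zero 0) g.1) f.1 f'.1)
  comp_add _ _ _ f g g' := Subtype.ext
    (LinearMap.congr_fun (map_add (𝒜.comp (add_zero 0)) g.1 g'.1) f.1)

variable (𝒜)

/-- Two closed morphisms of degree `0` are homotopic if their difference is a coboundary. -/
def homotopyRel : HomRel (Z0 𝒜) := fun X Y f g =>
  ∃ s : (𝒜.Hom X.obj Y.obj).X (-1), (𝒜.Hom X.obj Y.obj).d (-1) 0 s = f.1 - g.1

instance : Congruence (homotopyRel 𝒜) where
  equivalence :=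
    { refl := fun f => ⟨0, by simp⟩
      symm := fun ⟨s, hs⟩ => ⟨-s, by rw [map_neg, hs, neg_sub]⟩
      trans := fun ⟨s, hs⟩ ⟨t, ht⟩ => ⟨s + t, by rw [map_add, hs, ht, sub_add_sub_cancel]⟩ }
  comp_left := by
    rintro X Y Z f g g' ⟨s, hs⟩
    refine ⟨𝒜.comp (add_zero (-1)) s f.1, ?_⟩
    rw [𝒜.leibniz (add_zero (-1)) (neg_add_cancel 1) (zero_add 1) (neg_add_cancel 1), hs, f.d_eq]
    simp only [map_sub, LinearMap.sub_apply, map_zero, smul_zero, add_zero]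
    rfl
  comp_right := by
    rintro X Y Z f f' g ⟨s, hs⟩
    refine ⟨𝒜.comp (zero_add (-1)) g.1 s, ?_⟩
    rw [𝒜.leibniz (zero_add (-1)) (zero_add 1) (neg_add_cancel 1) (neg_add_cancel 1), hs, g.d_eq]
    simp only [map_sub, map_zero, LinearMap.zero_apply, zero_add, Int.negOnePow_zero, one_smul]
    rfl

/-- The homotopy category `H⁰(𝒜)`. -/
abbrev H0 := CategoryTheory.Quotient (homotopyRel 𝒜)

instance : Preadditive (H0 𝒜) :=
  Quotient.preadditive _ (by
    rintro X Y f₁ f₂ g₁ g₂ ⟨s, hs⟩ ⟨t, ht⟩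
    exact ⟨s + t, by rw [map_add, hs, ht]; exact sub_add_sub_comm _ _ _ _⟩)

variable {𝒜}

/-- The object of `H⁰(𝒜)` given by an object of `𝒜`. -/
def toH0 (X : 𝒜.Obj) : H0 𝒜 := (Quotient.functor (homotopyRel 𝒜)).obj ⟨X⟩

/-- The class in `H⁰(𝒜)` of a closed morphism of degree `0`. -/
def Closed.toH0 {X Y : 𝒜.Obj} (f : 𝒜.Closed X Y) : DGCategory.toH0 X ⟶ DGCategory.toH0 Y :=
  (Quotient.functor (homotopyRel 𝒜)).map (X := ⟨X⟩) (Y := ⟨Y⟩) f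

/-- A closed morphism of degree `0`, viewed in the opposite DG-category. -/
def Closed.op {X Y : 𝒜.Obj} (f : 𝒜.Closed X Y) : (DGCategory.op 𝒜).Closed Y X := f

/-- Postcomposition with `h : Y → Z` of degree `m`, as a cochain `𝒜(T, Y) → 𝒜(T, Z)` of degree
`m`, `x ↦ h ∘ x`. -/
def post (T : 𝒜.Obj) {Y Z : 𝒜.Obj} {m : ℤ} (h : (𝒜.Hom Y Z).X m) :
    Cochain (𝒜.Hom T Y) (𝒜.Hom T Z) m :=
  Cochain.mk fun p q hpq => ModuleCat.ofHom (𝒜.comp (by omega : m + p = q) h)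

lemma δ_post (T : 𝒜.Obj) {Y Z : 𝒜.Obj} {m m' : ℤ} (hm : m + 1 = m') (h : (𝒜.Hom Y Z).X m) :
    δ m m' (post T h) = post T ((𝒜.Hom Y Z).d m m' h) := by
  ext p q hpq x
  rw [δ_v m m' hm _ p q hpq (q - 1) (p + 1) rfl rfl]
  have := 𝒜.leibniz (by omega : m + p = q - 1) hm rfl (by omega : q - 1 + 1 = q) h x
  subst hm
  simp only [post, Cochain.mk_v, Int.negOnePow_succ]
  simp [this]

/-- The morphism of complexes `f^∧ : 𝒜(T, X) → 𝒜(T, Y)`, `x ↦ f ∘ x`, for `f` closed of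
degree `0`. -/
def postHom (T : 𝒜.Obj) {X Y : 𝒜.Obj} (f : 𝒜.Closed X Y) : 𝒜.Hom T X ⟶ 𝒜.Hom T Y where
  f p := ModuleCat.ofHom (𝒜.comp (zero_add p) f.1)
  comm' p q hpq := by
    ext x
    have := 𝒜.leibniz (zero_add p) (zero_add 1) hpq hpq f.1 x
    rw [f.d_eq] at this
    simpa using this

lemma ofHom_postHom_comp (T : 𝒜.Obj) {X Y Z : 𝒜.Obj} (f : 𝒜.Closed X Y) (g : 𝒜.Closed Y Z) :
    Cochain.ofHom (postHom T f ≫ postHom T g) = post T (𝒜.comp (add_zero 0) g.1 f.1) := by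
  ext p x
  simpa [post, postHom] using
    (𝒜.assoc (add_zero 0) (zero_add p) (zero_add p) (zero_add p) g.1 f.1 x).symm

variable (𝒜)

/-- A 3-term homotopy complex `X ⟶ Y ⟶ Z`: closed morphisms `f`, `g` of degree `0` and a morphism
`h : X ⟶ Z` of degree `-1` with `d h = - g ∘ f`. -/
structure ThreeTerm where
  {X Y Z : 𝒜.Obj}
  f : 𝒜.Closed X Y
  g : 𝒜.Closed Y Z
  h : (𝒜.Hom X Z).X (-1)
  d_h : (𝒜.Hom X Z).d (-1) 0 h = -𝒜.comp (add_zero 0) g.1 f.1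

/-- A homotopy commutative square, with `d s = f' ∘ a - b ∘ f`:
```
X  --f--> Y
|a        |b
v         v
X' --f'-> Y'
``` -/
structure Square where
  {X Y X' Y' : 𝒜.Obj}
  f : 𝒜.Closed X Y
  a : 𝒜.Closed X X'
  b : 𝒜.Closed Y Y'
  f' : 𝒜.Closed X' Y'
  s : (𝒜.Hom X Y').X (-1)
  d_s : (𝒜.Hom X Y').d (-1) 0 s =
    𝒜.comp (add_zero 0) f'.1 a.1 - 𝒜.comp (add_zero 0) b.1 f.1

variable {𝒜}

namespace ThreeTerm

/-- The dual of a 3-term homotopy complex. -/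
def op (c : 𝒜.ThreeTerm) : (DGCategory.op 𝒜).ThreeTerm where
  f := c.g.op
  g := c.f.op
  h := c.h
  d_h := c.d_h.trans (by simp [DGCategory.op, Closed.op]; rfl)

/-- The morphism of complexes
`𝒜(T, X) ⟶ Cone(g ∘ - : 𝒜(T, Y) ⟶ 𝒜(T, Z))[-1]`, `x ↦ (f ∘ x, h ∘ x)`. -/
noncomputable def toCocone (c : 𝒜.ThreeTerm) (T : 𝒜.Obj) :
    𝒜.Hom T c.X ⟶ mappingCocone (postHom T c.g) :=
  mappingCocone.lift (postHom T c.g) (postHom T c.f) (post T c.h) (by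
    rw [δ_post T (neg_add_cancel 1), c.d_h, ofHom_postHom_comp]
    ext p x
    simp [post])

/-- `(f, g, h)` is left exact (`f` is the homotopy kernel of `g`): for every `T`, the morphism
`𝒜(T, X) ⟶ Cone(𝒜(T, Y) ⟶ 𝒜(T, Z))[-1]` induces isomorphisms on `Hⁱ` for all `i ≤ 0`. -/
def IsLeftExact (c : 𝒜.ThreeTerm) : Prop :=
  ∀ (T : 𝒜.Obj) (i : ℤ), i ≤ 0 → QuasiIsoAt (c.toCocone T) i

/-- `(f, g, h)` is right exact (`g` is the homotopy cokernel of `f`): it is left exact in the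
opposite DG-category. -/
def IsRightExact (c : 𝒜.ThreeTerm) : Prop := c.op.IsLeftExact

/-- Homotopy short exact sequences. -/
def IsShortExact (c : 𝒜.ThreeTerm) : Prop := c.IsLeftExact ∧ c.IsRightExact

/-- Two 3-term homotopy complexes are equivalent if there is a (homotopy coherent) morphism
`(r₁, r₂, r₃, s₁, s₂, t)` between them with `r₁`, `r₂`, `r₃` homotopy equivalences. -/
def Equivalent (c c' : 𝒜.ThreeTerm) : Prop :=
  ∃ (r₁ : 𝒜.Closed c.X c'.X) (r₂ : 𝒜.Closed c.Y c'.Y) (r₃ : 𝒜.Closed c.Z c'.Z)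
    (s₁ : (𝒜.Hom c.X c'.Y).X (-1)) (s₂ : (𝒜.Hom c.Y c'.Z).X (-1)) (t : (𝒜.Hom c.X c'.Z).X (-2)),
    IsIso r₁.toH0 ∧ IsIso r₂.toH0 ∧ IsIso r₃.toH0 ∧
    (𝒜.Hom c.X c'.Y).d (-1) 0 s₁ =
      𝒜.comp (add_zero 0) c'.f.1 r₁.1 - 𝒜.comp (add_zero 0) r₂.1 c.f.1 ∧
    (𝒜.Hom c.Y c'.Z).d (-1) 0 s₂ =
      𝒜.comp (add_zero 0) c'.g.1 r₂.1 - 𝒜.comp (add_zero 0) r₃.1 c.g.1 ∧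
    (𝒜.Hom c.X c'.Z).d (-2) (-1) t =
      𝒜.comp (zero_add (-1)) r₃.1 c.h - 𝒜.comp (add_zero (-1)) s₂ c.f.1
        - 𝒜.comp (zero_add (-1)) c'.g.1 s₁ - 𝒜.comp (add_zero (-1)) c'.h r₁.1

end ThreeTerm

namespace Square

/-- The dual of a homotopy commutative square. -/
def op (q : 𝒜.Square) : (DGCategory.op 𝒜).Square where
  f := q.b.op
  a := q.f'.op
  b := q.f.op
  f' := q.a.op
  s := q.s
  d_s := q.d_s.trans (by simp [DGCategory.op, Closed.op]; rfl)

/-- The morphism of complexes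
`𝒜(T, X) ⟶ Cone((b, -f') : 𝒜(T, Y) ⊕ 𝒜(T, X') ⟶ 𝒜(T, Y'))[-1]`, `x ↦ ((f ∘ x, a ∘ x), s ∘ x)`. -/
noncomputable def toCocone (q : 𝒜.Square) (T : 𝒜.Obj) :
    𝒜.Hom T q.X ⟶ mappingCocone (biprod.desc (postHom T q.b) (-postHom T q.f')) :=
  mappingCocone.lift (biprod.desc (postHom T q.b) (-postHom T q.f'))
    (biprod.lift (postHom T q.f) (postHom T q.a)) (post T q.s) (by
    rw [δ_post T (neg_add_cancel 1), q.d_s, biprod.lift_desc, Preadditive.comp_neg,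
      Cochain.ofHom_add, Cochain.ofHom_neg, ofHom_postHom_comp, ofHom_postHom_comp]
    ext p x
    simp [post]
    abel)

/-- Homotopy cartesian squares (homotopy pullbacks). -/
def IsCartesian (q : 𝒜.Square) : Prop :=
  ∀ (T : 𝒜.Obj) (i : ℤ), i ≤ 0 → QuasiIsoAt (q.toCocone T) i

/-- Homotopy cocartesian squares (homotopy pushouts). -/
def IsCocartesian (q : 𝒜.Square) : Prop := q.op.IsCartesian

end Square

/-- `f` is an `n`-monomorphism: `Hⁱ(f^∧)` is a monomorphism for `i = 1 - n` and an isomorphism for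
`i ≤ -n`. These are morphisms of modules over `H⁰(𝒜)`, so this is tested at each object `T`.
For `n = ∞` there is no condition. -/
def IsNMono (n : ℕ∞) {X Y : 𝒜.Obj} (f : 𝒜.Closed X Y) : Prop :=
  ∀ m : ℕ, (m : ℕ∞) = n → ∀ T : 𝒜.Obj,
    Mono (HomologicalComplex.homologyMap (postHom T f) (1 - (m : ℤ))) ∧
      ∀ i : ℤ, i ≤ -(m : ℤ) → IsIso (HomologicalComplex.homologyMap (postHom T f) i)

/-- `f` is an `n`-epimorphism: it is an `n`-monomorphism in the opposite DG-category. -/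
def IsNEpi (n : ℕ∞) {X Y : 𝒜.Obj} (f : 𝒜.Closed X Y) : Prop := IsNMono n f.op

variable (𝒜)

/-- `𝒜` is additive: `H⁰(𝒜)` is an additive category. -/
def IsAdditive : Prop := HasFiniteBiproducts (H0 𝒜)

/-- `𝒜` is non-positive: its morphism complexes vanish in positive degrees. -/
def IsNonpositive : Prop := ∀ (X Y : 𝒜.Obj) (i : ℤ), 0 < i → IsZero ((𝒜.Hom X Y).X i)

/-- `𝒜` is `n`-truncated: it is non-positive and `Hⁱ(𝒜(X, Y)) = 0` for all `i ≤ -n`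
(no condition on the cohomology for `n = ∞`). -/
def IsTruncated (n : ℕ∞) : Prop :=
  𝒜.IsNonpositive ∧
    ∀ (X Y : 𝒜.Obj) (m : ℕ), n ≤ m → IsZero ((𝒜.Hom X Y).homology (-(m : ℤ)))

/-- `𝒜` is preabelian: it is additive and each closed morphism of degree `0` has a homotopy kernel
and a homotopy cokernel. -/
structure IsPreabelian : Prop where
  additive : 𝒜.IsAdditive
  exists_kernel : ∀ {Y Z : 𝒜.Obj} (g : 𝒜.Closed Y Z), ∃ (X : 𝒜.Obj) (f : 𝒜.Closed X Y)
    (h : (𝒜.Hom X Z).X (-1))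
    (d_h : (𝒜.Hom X Z).d (-1) 0 h = -𝒜.comp (add_zero 0) g.1 f.1),
    (ThreeTerm.mk f g h d_h).IsLeftExact
  exists_cokernel : ∀ {X Y : 𝒜.Obj} (f : 𝒜.Closed X Y), ∃ (Z : 𝒜.Obj) (g : 𝒜.Closed Y Z)
    (h : (𝒜.Hom X Z).X (-1))
    (d_h : (𝒜.Hom X Z).d (-1) 0 h = -𝒜.comp (add_zero 0) g.1 f.1),
    (ThreeTerm.mk f g h d_h).IsRightExact

/-- Abelian `n`-truncated DG-categories. -/
structure IsAbelianTruncated (n : ℕ∞) : Prop where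
  truncated : 𝒜.IsTruncated n
  preabelian : 𝒜.IsPreabelian
  shortExact_of_nMono : ∀ c : 𝒜.ThreeTerm, c.IsRightExact → IsNMono n c.f → c.IsShortExact
  shortExact_of_nEpi : ∀ c : 𝒜.ThreeTerm, c.IsLeftExact → IsNEpi n c.g → c.IsShortExact

variable {𝒜}

/-- `f` is an inflation for the class `S` of conflations: it is the first morphism of some
conflation. -/
def IsInflation (S : Set 𝒜.ThreeTerm) {X Y : 𝒜.Obj} (f : 𝒜.Closed X Y) : Prop :=
  ∃ (Z : 𝒜.Obj) (g : 𝒜.Closed Y Z) (h : (𝒜.Hom X Z).X (-1))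
    (d_h : (𝒜.Hom X Z).d (-1) 0 h = -𝒜.comp (add_zero 0) g.1 f.1), ThreeTerm.mk f g h d_h ∈ S

/-- `g` is a deflation for the class `S` of conflations: it is the second morphism of some
conflation. -/
def IsDeflation (S : Set 𝒜.ThreeTerm) {Y Z : 𝒜.Obj} (g : 𝒜.Closed Y Z) : Prop :=
  ∃ (X : 𝒜.Obj) (f : 𝒜.Closed X Y) (h : (𝒜.Hom X Z).X (-1))
    (d_h : (𝒜.Hom X Z).d (-1) 0 h = -𝒜.comp (add_zero 0) g.1 f.1), ThreeTerm.mk f g h d_h ∈ S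

variable (𝒜)

/-- The class `S` of conflations makes `𝒜` an exact DG-category. -/
structure IsExact (S : Set 𝒜.ThreeTerm) : Prop where
  additive : 𝒜.IsAdditive
  shortExact : ∀ c ∈ S, c.IsShortExact
  mem_of_equivalent : ∀ c c' : 𝒜.ThreeTerm, c.Equivalent c' → c ∈ S → c' ∈ S
  /-- (Ex0) The identity of a zero object is a deflation. -/
  ex0 : ∀ O : 𝒜.Obj, IsZero (toH0 O) → IsDeflation S (closedId O)
  /-- (Ex1) Deflations and inflations are closed under composition. -/
  ex1 : ∀ {X Y Z : 𝒜.Obj} (f : 𝒜.Closed X Y) (g : 𝒜.Closed Y Z),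
    IsDeflation S f → IsDeflation S g → IsDeflation S (closedComp g f)
  ex1' : ∀ {X Y Z : 𝒜.Obj} (f : 𝒜.Closed X Y) (g : 𝒜.Closed Y Z),
    IsInflation S f → IsInflation S g → IsInflation S (closedComp g f)
  /-- (Ex2) A deflation has homotopy pullbacks along all closed morphisms of degree `0`, and they
  are deflations. -/
  ex2 : ∀ {B C C' : 𝒜.Obj} (p : 𝒜.Closed B C) (c : 𝒜.Closed C' C), IsDeflation S p →
    ∃ (B' : 𝒜.Obj) (p' : 𝒜.Closed B' C') (b : 𝒜.Closed B' B) (s : (𝒜.Hom B' C).X (-1))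
      (d_s : (𝒜.Hom B' C).d (-1) 0 s =
        𝒜.comp (add_zero 0) p.1 b.1 - 𝒜.comp (add_zero 0) c.1 p'.1),
      (Square.mk p' b c p s d_s).IsCartesian
  ex2_stable : ∀ q : 𝒜.Square, q.IsCartesian → IsDeflation S q.f' → IsDeflation S q.f
  /-- (Ex2') An inflation has homotopy pushouts along all closed morphisms of degree `0`, and they
  are inflations. -/
  ex2' : ∀ {A A' B : 𝒜.Obj} (i : 𝒜.Closed A B) (a : 𝒜.Closed A A'), IsInflation S i →
    ∃ (B' : 𝒜.Obj) (i' : 𝒜.Closed A' B') (b : 𝒜.Closed B B') (s : (𝒜.Hom A B').X (-1))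
      (d_s : (𝒜.Hom A B').d (-1) 0 s =
        𝒜.comp (add_zero 0) i'.1 a.1 - 𝒜.comp (add_zero 0) b.1 i.1),
      (Square.mk i a b i' s d_s).IsCocartesian
  ex2'_stable : ∀ q : 𝒜.Square, q.IsCocartesian → IsInflation S q.f → IsInflation S q.f'

end DGCategory

/-! In an `n`-truncated DG-category an `n`-monomorphism is a morphism that is injective on
cohomology in the single degree `1 - n`, because both sides vanish in degrees `≤ -n`; dually for
`n`-epimorphisms. For `n = ∞` both conditions are empty.

Inflations are exactly the `n`-monomorphisms. If `f` is the homotopy kernel of `g : Y ⟶ Z`, the long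
exact sequence of the cocone contains `H⁻ⁿ(T, Z) → H¹⁻ⁿ(T, X) → H¹⁻ⁿ(T, Y)`, whose first term is
zero, so `f` is an `n`-monomorphism. Conversely the abelian axiom makes an `n`-monomorphism and its
homotopy cokernel into a homotopy short exact sequence. Deflations are dual. Closure under
composition is then the composition of injective maps.

A homotopy cartesian square amounts to a left exact sequence `X ⟶ Y ⊞ X' ⟶ Y'`
(`Square.isCartesian_iff`), so pullbacks exist as kernels. For base change, let `f'` be an
`n`-epimorphism. The map `Y ⊞ X' ⟶ Y'` restricts to `-f'` on `X'`, hence is itself an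
`n`-epimorphism, and the abelian axiom makes the sequence right exact. If `y ∘ f` is null, `y`
extended by zero to `Y ⊞ X'` then factors through `Y'` up to homotopy; the factor vanishes on
composition with `f'`, hence is null, and so is `y` (`Coexact.epiAt`). Pushouts are handled in the
opposite category.

Both the comparison of squares with sequences and the closure of conflations under equivalence rest
on one fact: a homotopy coherent morphism made of quasi-isomorphisms preserves and reflects the
condition that the first term computes the cocone (`mappingCocone.quasiIsoAt_lift_iff`). This is a
five lemma for cocones, proved by chasing elements. -/

namespace CochainComplex

/-! ### Cohomology of complexes of modules in terms of elements -/

section Elements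

variable {k : Type w} [CommRing k] {K L : CochainComplex (ModuleCat.{v} k) ℤ}

lemma map_d_apply (f : K ⟶ L) {i j : ℤ} (x : K.X i) :
    f.f j (K.d i j x) = L.d i j (f.f i x) := by
  rw [← ConcreteCategory.comp_apply, ← ConcreteCategory.comp_apply, f.comm]

lemma exists_cycles_of_d_eq_zero {i j : ℤ} (hij : i + 1 = j) (x : K.X i) (hx : K.d i j x = 0) :
    ∃ c : K.cycles i, K.iCycles i c = x := by
  have := ShortComplex.exact_of_f_is_kernel
    (ShortComplex.mk (K.iCycles i) (K.d i j) (K.iCycles_d i j))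
    (K.cyclesIsKernel i j (by simpa using hij))
  exact (ShortComplex.moduleCat_exact_iff _).1 this x hx

lemma homologyπ_eq_zero_iff {h i : ℤ} (hhi : h + 1 = i) (c : K.cycles i) :
    K.homologyπ i c = 0 ↔ ∃ w, K.d h i w = K.iCycles i c := by
  have := ShortComplex.exact_of_g_is_cokernel
    (ShortComplex.mk (K.toCycles h i) (K.homologyπ i) (K.toCycles_comp_homologyπ h i))
    (K.homologyIsCokernel h i (by simp [← hhi]))
  have hinj : Function.Injective (K.iCycles i) := (ModuleCat.mono_iff_injective _).1 inferInstance
  have hw (w) : K.iCycles i (K.toCycles h i w) = K.d h i w := by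
    rw [← ConcreteCategory.comp_apply, K.toCycles_i]
  constructor
  · intro hc
    obtain ⟨w, hw'⟩ := (ShortComplex.moduleCat_exact_iff _).1 this c hc
    exact ⟨w, by rw [← hw']; exact (hw w).symm⟩
  · rintro ⟨w, hw'⟩
    have : c = K.toCycles h i w := hinj (by rw [hw, hw'])
    rw [this, ← ConcreteCategory.comp_apply, K.toCycles_comp_homologyπ]
    rfl

lemma homologyπ_surjective (i : ℤ) : Function.Surjective (K.homologyπ i) :=
  (ModuleCat.epi_iff_surjective _).1 inferInstance

lemma d_iCycles_apply (i j : ℤ) (c : K.cycles i) : K.d i j (K.iCycles i c) = 0 := by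
  rw [← ConcreteCategory.comp_apply, K.iCycles_d]; rfl

lemma homologyMap_π_apply (f : K ⟶ L) (i : ℤ) (c : K.cycles i) :
    HomologicalComplex.homologyMap f i (K.homologyπ i c) =
      L.homologyπ i (HomologicalComplex.cyclesMap f i c) := by
  rw [← ConcreteCategory.comp_apply, ← ConcreteCategory.comp_apply,
    HomologicalComplex.homologyπ_naturality]

lemma cyclesMap_i_apply (f : K ⟶ L) (i : ℤ) (c : K.cycles i) :
    L.iCycles i (HomologicalComplex.cyclesMap f i c) = f.f i (K.iCycles i c) := by
  rw [← ConcreteCategory.comp_apply, ← ConcreteCategory.comp_apply,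
    HomologicalComplex.cyclesMap_i]

lemma mono_homologyMap_iff (f : K ⟶ L) {h i j : ℤ} (hhi : h + 1 = i) (hij : i + 1 = j) :
    Mono (HomologicalComplex.homologyMap f i) ↔
      ∀ x : K.X i, K.d i j x = 0 → ∀ y : L.X h, L.d h i y = f.f i x → ∃ w, K.d h i w = x := by
  rw [ModuleCat.mono_iff_injective, injective_iff_map_eq_zero]
  constructor
  · intro H x hx y hy
    obtain ⟨c, rfl⟩ := exists_cycles_of_d_eq_zero hij x hx
    rw [← homologyπ_eq_zero_iff hhi]
    apply H
    rw [homologyMap_π_apply, homologyπ_eq_zero_iff hhi, cyclesMap_i_apply]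
    exact ⟨y, hy⟩
  · intro H a ha
    obtain ⟨c, rfl⟩ := homologyπ_surjective i a
    rw [homologyMap_π_apply, homologyπ_eq_zero_iff hhi, cyclesMap_i_apply] at ha
    obtain ⟨y, hy⟩ := ha
    rw [homologyπ_eq_zero_iff hhi]
    exact H _ (d_iCycles_apply i j c) y hy

lemma epi_homologyMap_iff (f : K ⟶ L) {h i j : ℤ} (hhi : h + 1 = i) (hij : i + 1 = j) :
    Epi (HomologicalComplex.homologyMap f i) ↔
      ∀ y : L.X i, L.d i j y = 0 → ∃ x, K.d i j x = 0 ∧ ∃ w, L.d h i w = f.f i x - y := by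
  rw [ModuleCat.epi_iff_surjective]
  constructor
  · intro H y hy
    obtain ⟨c, rfl⟩ := exists_cycles_of_d_eq_zero hij y hy
    obtain ⟨a, ha⟩ := H (L.homologyπ i c)
    obtain ⟨b, rfl⟩ := homologyπ_surjective i a
    refine ⟨K.iCycles i b, d_iCycles_apply i j b, ?_⟩
    rw [← cyclesMap_i_apply, ← map_sub, ← homologyπ_eq_zero_iff hhi, map_sub, ← ha,
      homologyMap_π_apply, sub_self]
  · intro H a
    obtain ⟨c, rfl⟩ := homologyπ_surjective i a
    obtain ⟨x, hx, w, hw⟩ := H _ (d_iCycles_apply i j c)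
    obtain ⟨b, rfl⟩ := exists_cycles_of_d_eq_zero hij x hx
    refine ⟨K.homologyπ i b, ?_⟩
    rw [homologyMap_π_apply, ← sub_eq_zero, ← map_sub, homologyπ_eq_zero_iff hhi]
    exact ⟨w, by rw [hw, map_sub, cyclesMap_i_apply]⟩

lemma quasiIsoAt_iff_elements (f : K ⟶ L) {h i j : ℤ} (hhi : h + 1 = i) (hij : i + 1 = j) :
    QuasiIsoAt f i ↔
      (∀ x : K.X i, K.d i j x = 0 → ∀ y : L.X h, L.d h i y = f.f i x → ∃ w, K.d h i w = x) ∧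
      ∀ y : L.X i, L.d i j y = 0 → ∃ x, K.d i j x = 0 ∧ ∃ w, L.d h i w = f.f i x - y := by
  rw [← mono_homologyMap_iff f hhi hij, ← epi_homologyMap_iff f hhi hij,
    quasiIsoAt_iff_isIso_homologyMap]
  exact ⟨fun _ => ⟨inferInstance, inferInstance⟩, fun ⟨_, _⟩ => isIso_of_mono_of_epi _⟩

lemma isZero_homology_iff (K : CochainComplex (ModuleCat.{v} k) ℤ) {h i j : ℤ} (hhi : h + 1 = i)
    (hij : i + 1 = j) :
    IsZero (K.homology i) ↔ ∀ x : K.X i, K.d i j x = 0 → ∃ w, K.d h i w = x := by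
  rw [ModuleCat.isZero_iff_subsingleton]
  constructor
  · intro H x hx
    obtain ⟨c, rfl⟩ := exists_cycles_of_d_eq_zero hij x hx
    exact (homologyπ_eq_zero_iff hhi c).1 (Subsingleton.elim _ _)
  · intro H
    refine subsingleton_of_forall_eq 0 fun a => ?_
    obtain ⟨c, rfl⟩ := homologyπ_surjective i a
    exact (homologyπ_eq_zero_iff hhi c).2 (H _ (d_iCycles_apply i j c))

end Elements

/-! ### Mapping cocones: differential, functoriality and exact sequences -/

namespace mappingCocone

section

variable {C : Type*} [Category* C] [Preadditive C] {K L : CochainComplex C ℤ} (φ : K ⟶ L)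
  [HomologicalComplex.HasHomotopyCofiber φ]

variable {φ} in
lemma hom_ext {A : C} {p q : ℤ} (hpq : p + -1 = q) {f g : A ⟶ (mappingCocone φ).X p}
    (h₁ : f ≫ (fst φ).f p = g ≫ (fst φ).f p)
    (h₂ : f ≫ (snd φ).v p q hpq = g ≫ (snd φ).v p q hpq) : f = g := by
  rw [← Category.comp_id f, ← Category.comp_id g, ← id_X φ p q hpq, Preadditive.comp_add,
    Preadditive.comp_add, reassoc_of% h₁, reassoc_of% h₂]

/-- Presents the projection as a descended cochain, so that its differential can be read off from
`δ_descCochain`. -/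
lemma snd_eq_descCochain :
    snd φ = descCochain φ 0 (Cochain.ofHom (𝟙 L)) (neg_add_cancel 1) := by
  ext p q hpq
  rw [← Category.id_comp ((snd φ).v p q hpq), ← Category.id_comp ((descCochain φ _ _ _).v p q hpq),
    ← id_X φ p q hpq]
  simp

@[simp]
lemma δ_snd : δ (-1) 0 (snd φ) = -Cochain.ofHom (fst φ ≫ φ) := by
  rw [snd_eq_descCochain, δ_descCochain φ _ _ _ 1 (zero_add 1)]
  simp [Cochain.ofHom_comp]

/-- Fixes the sign convention: the cocone differential is `(y, z) ↦ (d y, -φ y - d z)`. The signs of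
the elements chosen in the chases below come from here. -/
lemma d_snd_v (p q r : ℤ) (hpq : p + 1 = q) (hr : p + -1 = r) :
    (mappingCocone φ).d p q ≫ (snd φ).v q p (by lia) =
      -(fst φ).f p ≫ φ.f p - (snd φ).v p r hr ≫ L.d r p := by
  have h := Cochain.congr_v (δ_snd φ) p p (add_zero p)
  rw [δ_v (-1) 0 (neg_add_cancel 1) _ p p (add_zero p) r q (by lia) hpq] at h
  simp only [Int.negOnePow_zero, one_smul, Cochain.neg_v, Cochain.ofHom_v,
    HomologicalComplex.comp_f] at h
  rw [← h]
  abel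

end

section

variable {k : Type w} [CommRing k] {K L M : CochainComplex (ModuleCat.{v} k) ℤ} (φ : K ⟶ L)

lemma fst_d_apply (p q : ℤ) (c : (mappingCocone φ).X p) :
    (fst φ).f q ((mappingCocone φ).d p q c) = K.d p q ((fst φ).f p c) :=
  map_d_apply (fst φ) c

lemma snd_d_apply (p q r : ℤ) (hpq : p + 1 = q) (hr : p + -1 = r) (c : (mappingCocone φ).X p) :
    (snd φ).v q p (by lia) ((mappingCocone φ).d p q c) =
      -φ.f p ((fst φ).f p c) - L.d r p ((snd φ).v p r hr c) :=
  ConcreteCategory.congr_hom (d_snd_v φ p q r hpq hr) c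

lemma lift_fst_apply (α : M ⟶ K) (β : Cochain M L (-1)) (h) (p : ℤ) (x : M.X p) :
    (fst φ).f p ((lift φ α β h).f p x) = α.f p x :=
  ConcreteCategory.congr_hom (lift_f_fst_f φ α β h p) x

lemma lift_snd_apply (α : M ⟶ K) (β : Cochain M L (-1)) (h) (p q : ℤ) (hpq : p + -1 = q)
    (x : M.X p) : (snd φ).v p q hpq ((lift φ α β h).f p x) = β.v p q hpq x :=
  ConcreteCategory.congr_hom (lift_f_snd_v φ α β h p q hpq) x

/-- The element of the mapping cocone with the given components. -/
noncomputable def elt {p q : ℤ} (hpq : p + -1 = q) (y : K.X p) (z : L.X q) :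
    (mappingCocone φ).X p :=
  (inl φ).v p p (add_zero p) y + (inr φ).1.v q p (by lia) z

@[simp]
lemma fst_elt {p q : ℤ} (hpq : p + -1 = q) (y : K.X p) (z : L.X q) :
    (fst φ).f p (elt φ hpq y z) = y := by
  have h₁ := ConcreteCategory.congr_hom (inl_v_fst_f φ p) y
  have h₂ := ConcreteCategory.congr_hom (inr_v_fst_f φ q p (by lia)) z
  rw [ConcreteCategory.comp_apply] at h₁ h₂
  rw [elt, map_add, h₁, h₂]
  exact add_zero y

@[simp]
lemma snd_elt {p q : ℤ} (hpq : p + -1 = q) (y : K.X p) (z : L.X q) :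
    (snd φ).v p q hpq (elt φ hpq y z) = z := by
  have h₁ := ConcreteCategory.congr_hom (inl_v_snd_v φ p q hpq) y
  have h₂ := ConcreteCategory.congr_hom (inr_v_snd_v φ q p (by lia)) z
  rw [ConcreteCategory.comp_apply] at h₁ h₂
  rw [elt, map_add, h₁, h₂]
  exact zero_add z

variable {φ} in
lemma elt_ext {p q : ℤ} (hpq : p + -1 = q) {c c' : (mappingCocone φ).X p}
    (h₁ : (fst φ).f p c = (fst φ).f p c') (h₂ : (snd φ).v p q hpq c = (snd φ).v p q hpq c') :
    c = c' := by
  have h (c : (mappingCocone φ).X p) :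
      c = elt φ hpq ((fst φ).f p c) ((snd φ).v p q hpq c) :=
    (ConcreteCategory.congr_hom (id_X φ p q hpq) c).symm
  rw [h c, h c', h₁, h₂]

end

section

variable {C : Type*} [Category* C] [Preadditive C] [HasBinaryBiproducts C]
  {K L M K' L' M' : CochainComplex C ℤ} (φ : K ⟶ L) (φ' : K' ⟶ L')

/-- The morphism of mapping cocones induced by a homotopy commutative square. -/
noncomputable def mapOfδ (r₂ : K ⟶ K') (r₃ : L ⟶ L') (s : Cochain K L' (-1))
    (hs : δ (-1) 0 s = Cochain.ofHom (r₂ ≫ φ') - Cochain.ofHom (φ ≫ r₃)) :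
    mappingCocone φ ⟶ mappingCocone φ' :=
  lift φ' (fst φ ≫ r₂)
    ((snd φ).comp (Cochain.ofHom r₃) (add_zero _) - (Cochain.ofHom (fst φ)).comp s (zero_add _)) (by
    simp only [δ_sub, δ_comp_ofHom, δ_ofHom_comp, δ_snd, hs, Cochain.ofHom_comp, Cochain.comp_sub,
      Cochain.neg_comp, Cochain.comp_assoc_of_third_is_zero_cochain]
    abel)

/-- The data of a homotopy coherent morphism are what is needed for the square formed by the two
lifts to commute up to homotopy: `s₁` and `t` are the two components of that homotopy. -/
lemma mapOfδ_homotopy {α : M ⟶ K} {β : Cochain M L (-1)} {h}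
    {α' : M' ⟶ K'} {β' : Cochain M' L' (-1)} {h'}
    (r₁ : M ⟶ M') (r₂ : K ⟶ K') (r₃ : L ⟶ L') (s₁ : Cochain M K' (-1)) (s₂ : Cochain K L' (-1))
    (t : Cochain M L' (-2))
    (hs₁ : δ (-1) 0 s₁ = Cochain.ofHom (r₁ ≫ α') - Cochain.ofHom (α ≫ r₂))
    (hs₂ : δ (-1) 0 s₂ = Cochain.ofHom (r₂ ≫ φ') - Cochain.ofHom (φ ≫ r₃))
    (ht : δ (-2) (-1) t = β.comp (Cochain.ofHom r₃) (add_zero _) -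
      (Cochain.ofHom α).comp s₂ (zero_add _) - s₁.comp (Cochain.ofHom φ') (add_zero _) -
      (Cochain.ofHom r₁).comp β' (zero_add _)) :
    Nonempty (Homotopy (r₁ ≫ lift φ' α' β' h') (lift φ α β h ≫ mapOfδ φ φ' r₂ r₃ s₂ hs₂)) := by
  refine ⟨(Cochain.equivHomotopy _ _).symm ⟨liftCochain φ' s₁ t (by lia), ?_⟩⟩
  have ht' : δ (-2) (-1) t + s₁.comp (Cochain.ofHom φ') (add_zero _) =
      β.comp (Cochain.ofHom r₃) (add_zero _) - (Cochain.ofHom α).comp s₂ (zero_add _) -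
        (Cochain.ofHom r₁).comp β' (zero_add _) := by
    rw [ht]
    abel
  rw [δ_liftCochain _ _ _ _ _ (neg_add_cancel 1), hs₁, ht']
  ext p : 1
  have hv (X : Cochain M L' (-1)) :
      (X.comp (inr φ').1 (neg_add_cancel 1)).v p p (add_zero p) =
        X.v p (p + -1) rfl ≫ (inr φ').1.v (p + -1) p (by lia) :=
    Cochain.comp_v _ _ _ _ _ _ _ _
  refine hom_ext rfl ?_ ?_
  · simp only [Cochain.add_v, Cochain.sub_v, hv, Preadditive.add_comp, Preadditive.sub_comp,
      Category.assoc, inr_v_fst_f]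
    simp [mapOfδ]
  · simp only [Cochain.add_v, Cochain.sub_v, hv, Preadditive.add_comp, Preadditive.sub_comp,
      Category.assoc, inr_v_snd_v]
    simp [mapOfδ]

end

section

variable {k : Type w} [CommRing k] {K L M K' L' M' : CochainComplex (ModuleCat.{v} k) ℤ}
  (φ : K ⟶ L) (φ' : K' ⟶ L')

variable (r₂ : K ⟶ K') (r₃ : L ⟶ L') (s : Cochain K L' (-1))
  (hs : δ (-1) 0 s = Cochain.ofHom (r₂ ≫ φ') - Cochain.ofHom (φ ≫ r₃))

lemma fst_mapOfδ_apply (p : ℤ) (c : (mappingCocone φ).X p) :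
    (fst φ').f p ((mapOfδ φ φ' r₂ r₃ s hs).f p c) = r₂.f p ((fst φ).f p c) :=
  lift_fst_apply ..

lemma snd_mapOfδ_apply (p q : ℤ) (hpq : p + -1 = q) (c : (mappingCocone φ).X p) :
    (snd φ').v p q hpq ((mapOfδ φ φ' r₂ r₃ s hs).f p c) =
      r₃.f q ((snd φ).v p q hpq c) - s.v p q hpq ((fst φ).f p c) := by
  refine (lift_snd_apply ..).trans ?_
  simp

variable {φ φ' r₂ r₃ s} in
include hs in
lemma map_map_apply_eq_of_δ (o p q : ℤ) (hop : o + 1 = p) (hpq : p + 1 = q) (y : K.X p) :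
    r₃.f p (φ.f p y) = φ'.f p (r₂.f p y) - L'.d o p (s.v p o (by omega) y) -
      s.v q p (by omega) (K.d p q y) := by
  have h := ConcreteCategory.congr_hom (Cochain.congr_v hs p p (add_zero p)) y
  rw [δ_v (-1) 0 (neg_add_cancel 1) _ p p (add_zero p) o q (by omega) hpq] at h
  simp at h
  rw [sub_sub, h]
  abel

/-- The injectivity half of the five lemma: a cocycle `(y, z)` whose image bounds `(y', z')` is
bounded by first solving for `y` through `r₂`, then for `z` through `r₃`. -/
lemma mono_homologyMap_mapOfδ (h₂ : ∀ i, QuasiIsoAt r₂ i) (h₃ : ∀ i, QuasiIsoAt r₃ i) (i : ℤ) :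
    Mono (HomologicalComplex.homologyMap (mapOfδ φ φ' r₂ r₃ s hs) i) := by
  obtain ⟨h, hh⟩ : ∃ h, h + 1 = i := ⟨i - 1, by omega⟩
  obtain ⟨g, hg⟩ : ∃ g, g + 1 = h := ⟨h - 1, by omega⟩
  rw [mono_homologyMap_iff _ hh rfl]
  intro c hc c' hc'
  have hy : K.d i (i + 1) ((fst φ).f i c) = 0 := by rw [← fst_d_apply, hc, map_zero]
  have hz : -φ.f i ((fst φ).f i c) - L.d h i ((snd φ).v i h (by omega) c) = 0 := by
    rw [← snd_d_apply φ i (i + 1) h rfl (by omega), hc, map_zero]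
  have hy' : K'.d h i ((fst φ').f h c') = r₂.f i ((fst φ).f i c) := by
    rw [← fst_d_apply, hc', fst_mapOfδ_apply]
  have hz' : -φ'.f h ((fst φ').f h c') - L'.d g h ((snd φ').v h g (by omega) c') =
      r₃.f h ((snd φ).v i h (by omega) c) - s.v i h (by omega) ((fst φ).f i c) := by
    rw [← snd_d_apply φ' h i g (by omega) (by omega), hc', snd_mapOfδ_apply]
  suffices ∃ (y : K.X h) (z : L.X g), K.d h i y = (fst φ).f i c ∧
      -φ.f h y - L.d g h z = (snd φ).v i h (by omega) c by
    obtain ⟨y, z, hyz, hyz'⟩ := this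
    refine ⟨elt φ (by omega : h + -1 = g) y z, elt_ext (by omega : i + -1 = h) ?_ ?_⟩
    · rw [fst_d_apply, fst_elt, hyz]
    · rw [snd_d_apply φ h i g hh (by omega), fst_elt, snd_elt, hyz']
  generalize (fst φ).f i c = y at *
  generalize (snd φ).v i h (by omega) c = z at *
  generalize (fst φ').f h c' = y' at *
  generalize (snd φ').v h g (by omega) c' = z' at *
  clear hc' hc c c'
  obtain ⟨y₀, hy₀⟩ := ((quasiIsoAt_iff_elements r₂ hh rfl).1 (h₂ i)).1 y hy y' hy'
  -- The primitive `y₀` of `y` need not map to `y'`. Correcting it by a cocycle `y₁` makes its image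
  -- agree with `y'` up to `d w`, which is needed before `z` can be treated.
  obtain ⟨y₁, hy₁, w, hw⟩ := ((quasiIsoAt_iff_elements r₂ hg hh).1 (h₂ h)).2 (y' - r₂.f h y₀)
    (by rw [map_sub, hy', ← map_d_apply, hy₀, sub_self])
  have hd : K.d h i (y₀ + y₁) = y := by rw [map_add, hy₀, hy₁, add_zero]
  obtain ⟨z₀, hz₀⟩ := ((quasiIsoAt_iff_elements r₃ hg hh).1 (h₃ h)).1 (z + φ.f h (y₀ + y₁))
    (by
      rw [map_add, ← map_d_apply, hd, ← neg_eq_zero, ← hz]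
      abel)
    (-z' + φ'.f g w - s.v h g (by omega) (y₀ + y₁)) (by
      rw [map_add (ConcreteCategory.hom (r₃.f h)), map_map_apply_eq_of_δ hs g h i hg hh, hd,
        map_sub, map_add, map_neg, ← map_d_apply φ', hw, sub_eq_iff_eq_add.1 hz'.symm]
      simp only [map_add, map_sub]
      abel)
  refine ⟨y₀ + y₁, -z₀, hd, ?_⟩
  rw [map_neg, hz₀]
  abel

/-- The surjectivity half of the five lemma: `y'` is lifted first, then a second component is found
that makes the lift a cocycle. -/
lemma epi_homologyMap_mapOfδ (h₂ : ∀ i, QuasiIsoAt r₂ i) (h₃ : ∀ i, QuasiIsoAt r₃ i) (i : ℤ) :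
    Epi (HomologicalComplex.homologyMap (mapOfδ φ φ' r₂ r₃ s hs) i) := by
  obtain ⟨h, hh⟩ : ∃ h, h + 1 = i := ⟨i - 1, by omega⟩
  obtain ⟨g, hg⟩ : ∃ g, g + 1 = h := ⟨h - 1, by omega⟩
  rw [epi_homologyMap_iff _ hh rfl]
  intro c' hc'
  have hy' : K'.d i (i + 1) ((fst φ').f i c') = 0 := by rw [← fst_d_apply, hc', map_zero]
  have hz' : -φ'.f i ((fst φ').f i c') - L'.d h i ((snd φ').v i h (by omega) c') = 0 := by
    rw [← snd_d_apply φ' i (i + 1) h rfl (by omega), hc', map_zero]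
  suffices ∃ (y : K.X i) (z : L.X h) (w : K'.X h) (t : L'.X g), K.d i (i + 1) y = 0 ∧
      -φ.f i y - L.d h i z = 0 ∧ K'.d h i w = r₂.f i y - (fst φ').f i c' ∧
      -φ'.f h w - L'.d g h t =
        r₃.f h z - s.v i h (by omega) y - (snd φ').v i h (by omega) c' by
    obtain ⟨y, z, w, t, h₁, h₂, h₃, h₄⟩ := this
    refine ⟨elt φ (by omega : i + -1 = h) y z,
      elt_ext (by omega : i + 1 + -1 = i) ?_ ?_,
      elt φ' (by omega : h + -1 = g) w t, elt_ext (by omega : i + -1 = h) ?_ ?_⟩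
    · rw [fst_d_apply, fst_elt, h₁, map_zero]
    · rw [snd_d_apply φ i (i + 1) h rfl (by omega), fst_elt, snd_elt, h₂, map_zero]
    · rw [fst_d_apply, fst_elt, h₃, map_sub, fst_mapOfδ_apply, fst_elt]
    · rw [snd_d_apply φ' h i g hh (by omega), fst_elt, snd_elt, h₄, map_sub, snd_mapOfδ_apply,
        fst_elt, snd_elt]
  generalize (fst φ').f i c' = y' at *
  generalize (snd φ').v i h (by omega) c' = z' at *
  clear hc' c'
  obtain ⟨y, hy, w, hw⟩ := ((quasiIsoAt_iff_elements r₂ hh rfl).1 (h₂ i)).2 y' hy'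
  have hy₃ := map_map_apply_eq_of_δ hs h i (i + 1) hh rfl y
  rw [hy, map_zero, sub_zero] at hy₃
  have hz'' : L'.d h i z' = -φ'.f i y' := (sub_eq_zero.1 hz').symm
  have hφw : L'.d h i (φ'.f h w) = φ'.f i (r₂.f i y) - φ'.f i y' := by
    rw [← map_d_apply, hw, map_sub]
  -- Since `r₃ (φ y)` is a coboundary, so is `φ y`; thus `(y, -u)` is a cocycle of the cocone.
  obtain ⟨u, hu⟩ := ((quasiIsoAt_iff_elements r₃ hh rfl).1 (h₃ i)).1 (φ.f i y)
    (by rw [← map_d_apply, hy, map_zero])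
    (-z' + φ'.f h w - s.v i h (by omega) y) (by
      rw [hy₃, map_sub, map_add, hφw, map_neg, hz'']
      abel)
  -- The image of `(y, -u)` still differs from `(y', z')` in the second component; the difference is
  -- a cocycle once `φ' w` is taken into account, and `u₁` lifts it.
  obtain ⟨u₁, hu₁, t, ht⟩ := ((quasiIsoAt_iff_elements r₃ hg hh).1 (h₃ h)).2
    (z' - (r₃.f h (-u) - s.v i h (by omega) y) - φ'.f h w) (by
      rw [map_sub, map_sub, map_sub, ← map_d_apply r₃, map_neg, hu, map_neg, hy₃, hφw,
        hz'']
      abel)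
  refine ⟨y, -u + u₁, w, -t, hy, ?_, hw, ?_⟩
  · rw [map_add, map_neg, hu, hu₁]
    abel
  · rw [map_neg, ht, map_add (ConcreteCategory.hom (r₃.f h))]
    abel

lemma quasiIsoAt_mapOfδ (h₂ : ∀ i, QuasiIsoAt r₂ i) (h₃ : ∀ i, QuasiIsoAt r₃ i) (i : ℤ) :
    QuasiIsoAt (mapOfδ φ φ' r₂ r₃ s hs) i := by
  have := mono_homologyMap_mapOfδ φ φ' r₂ r₃ s hs h₂ h₃ i
  have := epi_homologyMap_mapOfδ φ φ' r₂ r₃ s hs h₂ h₃ i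
  rw [quasiIsoAt_iff_isIso_homologyMap]
  exact isIso_of_mono_of_epi _

include hs in
/-- A homotopy coherent morphism of sequences `M ⟶ K ⟶ L` consisting of quasi-isomorphisms
preserves and reflects the property that `M` computes the cohomology of the mapping cocone. -/
lemma quasiIsoAt_lift_iff {α : M ⟶ K} {β : Cochain M L (-1)} {h}
    {α' : M' ⟶ K'} {β' : Cochain M' L' (-1)} {h'} (r₁ : M ⟶ M') (s₁ : Cochain M K' (-1))
    (t : Cochain M L' (-2))
    (hs₁ : δ (-1) 0 s₁ = Cochain.ofHom (r₁ ≫ α') - Cochain.ofHom (α ≫ r₂))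
    (ht : δ (-2) (-1) t = β.comp (Cochain.ofHom r₃) (add_zero _) -
      (Cochain.ofHom α).comp s (zero_add _) - s₁.comp (Cochain.ofHom φ') (add_zero _) -
      (Cochain.ofHom r₁).comp β' (zero_add _))
    (h₁ : ∀ i, QuasiIsoAt r₁ i) (h₂ : ∀ i, QuasiIsoAt r₂ i) (h₃ : ∀ i, QuasiIsoAt r₃ i) (i : ℤ) :
    QuasiIsoAt (lift φ α β h) i ↔ QuasiIsoAt (lift φ' α' β' h') i := by
  obtain ⟨H⟩ := mapOfδ_homotopy φ φ' (h := h) (h' := h') r₁ r₂ r₃ s₁ s t hs₁ hs ht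
  have := quasiIsoAt_mapOfδ φ φ' r₂ r₃ s hs h₂ h₃ i
  have := h₁ i
  rw [← quasiIsoAt_iff_comp_left r₁, ← quasiIsoAt_iff_comp_right _ (mapOfδ φ φ' r₂ r₃ s hs),
    quasiIsoAt_iff_isIso_homologyMap, quasiIsoAt_iff_isIso_homologyMap, H.homologyMap_eq]

/-- Exactness of the cohomology sequence of a mapping cocone, in terms of elements. -/
lemma exists_of_quasiIsoAt_lift {α : M ⟶ K} {β : Cochain M L (-1)} {h} {g i j : ℤ}
    (hgi : g + 1 = i) (hij : i + 1 = j) (H : QuasiIsoAt (lift φ α β h) i) (y : K.X i)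
    (hy : K.d i j y = 0) (z : L.X g) (hz : L.d g i z = φ.f i y) :
    ∃ x, M.d i j x = 0 ∧ ∃ w, K.d g i w = α.f i x - y := by
  -- The null-homotopy `z` of `φ y` turns `y` into the cocycle `(y, -z)` of the cocone, which `M`
  -- reaches up to a coboundary.
  obtain ⟨x, hx, c, hc⟩ := ((quasiIsoAt_iff_elements _ hgi hij).1 H).2
    (elt φ (by omega : i + -1 = g) y (-z)) (elt_ext (by omega : j + -1 = i) (by
      rw [fst_d_apply, fst_elt, hy, map_zero]) (by
      rw [snd_d_apply φ i j g hij (by omega), fst_elt, snd_elt, map_neg, hz, map_zero]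
      abel))
  exact ⟨x, hx, (fst φ).f g c, by rw [← fst_d_apply, hc, map_sub, fst_elt, lift_fst_apply]⟩

/-- Exactness of the cohomology sequence of a mapping cocone, in terms of elements. -/
lemma exists_d_eq_of_quasiIsoAt_lift {α : M ⟶ K} {β : Cochain M L (-1)} {h} {f g i j : ℤ}
    (hfg : f + 1 = g) (hgi : g + 1 = i) (hij : i + 1 = j) (H : QuasiIsoAt (lift φ α β h) i)
    (hL : IsZero (L.homology g)) (x : M.X i) (hx : M.d i j x = 0) (y : K.X g)
    (hy : K.d g i y = α.f i x) : ∃ w, M.d g i w = x := by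
  have hβ : L.d g i (β.v i g (by omega) x) = -φ.f i (K.d g i y) := by
    have h := ConcreteCategory.congr_hom (Cochain.congr_v h i i (add_zero i)) x
    rw [Cochain.add_v, δ_v (-1) 0 (neg_add_cancel 1) _ i i (add_zero i) g j (by omega) hij] at h
    simp [hx] at h
    rw [hy]
    exact eq_neg_of_add_eq_zero_left h
  -- Both `β x` and `-φ y` are primitives of `-φ (α x)`. Their difference is a cocycle, hence some
  -- `d z`, and `(y, -z)` bounds the image of `x` in the cocone.
  obtain ⟨z, hz⟩ := (isZero_homology_iff L hfg hgi).1 hL (β.v i g (by omega) x + φ.f g y)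
    (by rw [map_add, hβ, ← map_d_apply, neg_add_cancel])
  refine ((quasiIsoAt_iff_elements _ hgi hij).1 H).1 x hx
    (elt φ (by omega : g + -1 = f) y (-z)) (elt_ext (by omega : i + -1 = g) ?_ ?_)
  · rw [fst_d_apply, fst_elt, hy, lift_fst_apply]
  · rw [snd_d_apply φ g i f hgi (by omega), fst_elt, snd_elt, map_neg, hz, lift_snd_apply]
    abel

end

end mappingCocone

end CochainComplex

namespace DGCategory

variable {k : Type w} [CommRing k] {𝒜 : DGCategory.{w, v, u} k}

/-! ### Cocycles, coboundaries and homotopic morphisms -/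

section Coboundaries

/-- A morphism which is a coboundary, i.e. homotopic to zero. -/
def IsCob {X Y : 𝒜.Obj} {i : ℤ} (x : (𝒜.Hom X Y).X i) : Prop :=
  ∃ w : (𝒜.Hom X Y).X (i - 1), (𝒜.Hom X Y).d (i - 1) i w = x

/-- Closed morphisms of arbitrary degree. -/
def IsCocycle {X Y : 𝒜.Obj} {i : ℤ} (x : (𝒜.Hom X Y).X i) : Prop :=
  (𝒜.Hom X Y).d i (i + 1) x = 0

variable {X Y Z T : 𝒜.Obj} {i : ℤ}

/-- Allows any index provably equal to `i - 1`, such as `-1` for `i = 0`. -/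
lemma isCob_iff {h : ℤ} (hh : h + 1 = i) (x : (𝒜.Hom X Y).X i) :
    IsCob x ↔ ∃ w, (𝒜.Hom X Y).d h i w = x := by
  obtain rfl : h = i - 1 := by omega
  rfl

lemma IsCob.add {x y : (𝒜.Hom X Y).X i} (hx : IsCob x) (hy : IsCob y) : IsCob (x + y) := by
  obtain ⟨a, rfl⟩ := hx
  obtain ⟨b, rfl⟩ := hy
  exact ⟨a + b, map_add _ _ _⟩

lemma IsCob.neg {x : (𝒜.Hom X Y).X i} (hx : IsCob x) : IsCob (-x) := by
  obtain ⟨a, rfl⟩ := hx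
  exact ⟨-a, map_neg _ _⟩

lemma IsCob.sub {x y : (𝒜.Hom X Y).X i} (hx : IsCob x) (hy : IsCob y) : IsCob (x - y) := by
  rw [sub_eq_add_neg]
  exact hx.add hy.neg

lemma IsCob.of_sub_left {x y : (𝒜.Hom X Y).X i} (h : IsCob (x - y)) (hx : IsCob x) :
    IsCob y := by
  simpa using hx.sub h

lemma IsCob.of_sub_right {x y : (𝒜.Hom X Y).X i} (h : IsCob (x - y)) (hy : IsCob y) :
    IsCob x := by
  simpa using h.add hy

lemma op_comp_apply {p q n : ℤ} (h : p + q = n) (g : (𝒜.Hom Z Y).X p) (f : (𝒜.Hom Y X).X q) :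
    𝒜.op.comp (X := X) (Y := Y) (Z := Z) h g f =
      (p * q).negOnePow • 𝒜.comp (by omega : q + p = n) f g := rfl

/-- The sign of the opposite composition is trivial when one factor has degree `0`, so arguments
with closed morphisms dualize without sign changes. -/
lemma op_comp_zero_left (f : 𝒜.Closed Z Y) (x : (𝒜.Hom Y X).X i) :
    𝒜.op.comp (X := X) (Y := Y) (Z := Z) (zero_add i) f.1 x = 𝒜.comp (add_zero i) x f.1 := by
  rw [op_comp_apply]
  simp
  rfl

lemma op_comp_zero_right (f : 𝒜.Closed Y X) (x : (𝒜.Hom Z Y).X i) :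
    𝒜.op.comp (X := X) (Y := Y) (Z := Z) (add_zero i) x f.1 = 𝒜.comp (zero_add i) f.1 x := by
  rw [op_comp_apply]
  simp
  rfl

lemma d_closed_comp {j : ℤ} (f : 𝒜.Closed Y Z) (x : (𝒜.Hom X Y).X i) :
    (𝒜.Hom X Z).d i j (𝒜.comp (zero_add i) f.1 x) =
      𝒜.comp (zero_add j) f.1 ((𝒜.Hom X Y).d i j x) :=
  (map_d_apply (postHom X f) x).symm

lemma d_comp_closed {j : ℤ} (x : (𝒜.Hom Y Z).X i) (f : 𝒜.Closed X Y) :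
    (𝒜.Hom X Z).d i j (𝒜.comp (add_zero i) x f.1) =
      𝒜.comp (add_zero j) ((𝒜.Hom Y Z).d i j x) f.1 := by
  have := d_closed_comp (𝒜 := 𝒜.op) (j := j) f.op x
  rw [← op_comp_zero_left, ← op_comp_zero_left]
  exact this

lemma IsCob.comp_closed (f : 𝒜.Closed X Y) {x : (𝒜.Hom Y Z).X i} (hx : IsCob x) :
    IsCob (𝒜.comp (add_zero i) x f.1) := by
  obtain ⟨w, rfl⟩ := hx
  exact ⟨_, d_comp_closed w f⟩

lemma IsCocycle.closed_comp (f : 𝒜.Closed Y Z) {x : (𝒜.Hom X Y).X i} (hx : IsCocycle x) :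
    IsCocycle (𝒜.comp (zero_add i) f.1 x) := by
  rw [IsCocycle] at *
  rw [d_closed_comp, hx, map_zero]

lemma IsCocycle.comp_closed (f : 𝒜.Closed X Y) {x : (𝒜.Hom Y Z).X i} (hx : IsCocycle x) :
    IsCocycle (𝒜.comp (add_zero i) x f.1) := by
  rw [IsCocycle] at *
  rw [d_comp_closed, hx, map_zero, LinearMap.zero_apply]

lemma IsCob.cocycle_comp {f : (𝒜.Hom X Y).X 0} (hf : IsCob f) {x : (𝒜.Hom Y Z).X i}
    (hx : IsCocycle x) : IsCob (𝒜.comp (add_zero i) x f) := by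
  obtain ⟨s, hs⟩ := (isCob_iff (neg_add_cancel 1) f).1 hf
  -- The factor `(-1) ^ i` cancels the sign in the Leibniz rule for `d (x ∘ s)`.
  refine ⟨i.negOnePow • 𝒜.comp (by omega) x s, ?_⟩
  rw [map_units_smul, 𝒜.leibniz (by omega : i + -1 = i - 1) rfl (neg_add_cancel 1) (by omega),
    hs, hx]
  simp [smul_smul]

/-- Homotopic closed morphisms of degree `0`. -/
def Homotopic (f f' : 𝒜.Closed X Y) : Prop := IsCob (f.1 - f'.1)

lemma Homotopic.symm {f f' : 𝒜.Closed X Y} (h : Homotopic f f') : Homotopic f' f := by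
  have := h.neg
  rwa [neg_sub] at this

lemma toH0_eq_iff (f f' : 𝒜.Closed X Y) : f.toH0 = f'.toH0 ↔ Homotopic f f' :=
  (Quotient.functor_map_eq_iff (homotopyRel 𝒜) (X := ⟨X⟩) (Y := ⟨Y⟩) f f').trans
    (isCob_iff (neg_add_cancel 1) _).symm

lemma exists_toH0_eq (φ : toH0 X ⟶ toH0 Y) : ∃ f : 𝒜.Closed X Y, f.toH0 = φ :=
  (Quotient.functor (homotopyRel 𝒜)).map_surjective (X := (⟨X⟩ : Z0 𝒜)) (Y := (⟨Y⟩ : Z0 𝒜)) φ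

lemma toH0_closedComp (g : 𝒜.Closed Y Z) (f : 𝒜.Closed X Y) :
    (closedComp g f).toH0 = f.toH0 ≫ g.toH0 :=
  (Quotient.functor (homotopyRel 𝒜)).map_comp (X := ⟨X⟩) (Y := ⟨Y⟩) (Z := ⟨Z⟩) f g

lemma toH0_closedId : (closedId X).toH0 = 𝟙 (toH0 X) :=
  (Quotient.functor (homotopyRel 𝒜)).map_id ⟨X⟩

lemma toH0_add (f g : 𝒜.Closed X Y) : (f + g).toH0 = f.toH0 + g.toH0 := rfl

lemma toH0_sub (f g : 𝒜.Closed X Y) : (f - g).toH0 = f.toH0 - g.toH0 :=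
  eq_sub_of_add_eq ((toH0_add _ _).symm.trans (congrArg _ (sub_add_cancel f g)))

lemma toH0_zero : (0 : 𝒜.Closed X Y).toH0 = 0 := rfl

lemma exists_homotopy_inverse {r : 𝒜.Closed X Y} (hr : IsIso r.toH0) :
    ∃ r' : 𝒜.Closed Y X, Homotopic (closedComp r' r) (closedId X) ∧
      Homotopic (closedComp r r') (closedId Y) := by
  obtain ⟨r', hr'⟩ := exists_toH0_eq (inv r.toH0)
  refine ⟨r', ?_, ?_⟩ <;> rw [← toH0_eq_iff, toH0_closedComp, toH0_closedId, hr'] <;> simp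

end Coboundaries

/-! ### Postcomposition with closed morphisms on cohomology -/

section PostHom

variable {X Y Z : 𝒜.Obj} (T : 𝒜.Obj)

lemma postHom_closedComp (g : 𝒜.Closed Y Z) (f : 𝒜.Closed X Y) :
    postHom T (closedComp g f) = postHom T f ≫ postHom T g := by
  ext p x
  exact 𝒜.assoc (add_zero 0) (zero_add p) (zero_add p) (zero_add p) g.1 f.1 x

lemma postHom_closedId : postHom T (closedId X) = 𝟙 _ := by
  ext p x
  exact 𝒜.id_comp x

lemma postHom_add (f g : 𝒜.Closed X Y) : postHom T (f + g) = postHom T f + postHom T g := by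
  ext p x
  simp [postHom]

lemma postHom_sub (f g : 𝒜.Closed X Y) : postHom T (f - g) = postHom T f - postHom T g := by
  ext p x
  simp [postHom]

lemma postHom_zero : postHom T (0 : 𝒜.Closed X Y) = 0 := by
  ext p x
  simp [postHom]

lemma ofHom_postHom (f : 𝒜.Closed X Y) : Cochain.ofHom (postHom T f) = post T f.1 := by
  ext p x
  simp [postHom, post]

lemma homologyMap_postHom_eq {f f' : 𝒜.Closed X Y} (h : Homotopic f f') (i : ℤ) :
    HomologicalComplex.homologyMap (postHom T f) i =
      HomologicalComplex.homologyMap (postHom T f') i := by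
  obtain ⟨s, hs⟩ := (isCob_iff (neg_add_cancel 1) _).1 h
  refine Homotopy.homologyMap_eq ((Cochain.equivHomotopy _ _).symm ⟨post T s, ?_⟩) i
  rw [δ_post T (neg_add_cancel 1), hs, ofHom_postHom, ofHom_postHom]
  ext p x
  simp [post]

lemma quasiIsoAt_postHom {r : 𝒜.Closed X Y} {r' : 𝒜.Closed Y X}
    (h : Homotopic (closedComp r' r) (closedId X)) (h' : Homotopic (closedComp r r') (closedId Y))
    (i : ℤ) : QuasiIsoAt (postHom T r) i := by
  rw [quasiIsoAt_iff_isIso_homologyMap]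
  refine ⟨HomologicalComplex.homologyMap (postHom T r') i, ?_, ?_⟩
  · rw [← HomologicalComplex.homologyMap_comp, ← postHom_closedComp, homologyMap_postHom_eq T h,
      postHom_closedId, HomologicalComplex.homologyMap_id]
  · rw [← HomologicalComplex.homologyMap_comp, ← postHom_closedComp, homologyMap_postHom_eq T h',
      postHom_closedId, HomologicalComplex.homologyMap_id]

end PostHom

/-! ### Injectivity on cohomology in one degree, and exact sequences -/

section Cancellation

/-- Postcomposition with `f` is injective on cohomology in degree `i`. -/
def MonoAt (i : ℤ) {X Y : 𝒜.Obj} (f : 𝒜.Closed X Y) : Prop :=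
  ∀ ⦃T : 𝒜.Obj⦄ ⦃x : (𝒜.Hom T X).X i⦄, IsCocycle x → IsCob (𝒜.comp (zero_add i) f.1 x) → IsCob x

/-- Precomposition with `f` is injective on cohomology in degree `i`. -/
def EpiAt (i : ℤ) {X Y : 𝒜.Obj} (f : 𝒜.Closed X Y) : Prop :=
  ∀ ⦃T : 𝒜.Obj⦄ ⦃x : (𝒜.Hom Y T).X i⦄, IsCocycle x → IsCob (𝒜.comp (add_zero i) x f.1) → IsCob x

variable {X Y Z : 𝒜.Obj} {i : ℤ}

lemma monoAt_op_iff (f : 𝒜.Closed X Y) : MonoAt i f.op ↔ EpiAt i f := by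
  refine forall_congr' fun T => forall_congr' fun x => imp_congr Iff.rfl (imp_congr ?_ Iff.rfl)
  exact iff_of_eq (congrArg (IsCob (𝒜 := 𝒜)) (op_comp_zero_left f x))

lemma epiAt_op_iff (f : 𝒜.Closed X Y) : EpiAt i f.op ↔ MonoAt i f := by
  refine forall_congr' fun T => forall_congr' fun x => imp_congr Iff.rfl (imp_congr ?_ Iff.rfl)
  exact iff_of_eq (congrArg (IsCob (𝒜 := 𝒜)) (op_comp_zero_right f x))

lemma comp_closedComp (x : (𝒜.Hom Y Z).X i) {W : 𝒜.Obj} (g : 𝒜.Closed X Y) (f : 𝒜.Closed W X) :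
    𝒜.comp (add_zero i) x (closedComp g f).1 =
      𝒜.comp (add_zero i) (𝒜.comp (add_zero i) x g.1) f.1 :=
  (𝒜.assoc _ _ _ _ x g.1 f.1).symm

lemma EpiAt.closedComp {f : 𝒜.Closed X Y} {g : 𝒜.Closed Y Z} (hf : EpiAt i f) (hg : EpiAt i g) :
    EpiAt i (DGCategory.closedComp g f) := by
  intro T x hx h
  rw [comp_closedComp] at h
  exact hg hx (hf (hx.comp_closed g) h)

lemma EpiAt.of_closedComp {f : 𝒜.Closed X Y} {g : 𝒜.Closed Y Z}
    (h : EpiAt i (DGCategory.closedComp g f)) :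
    EpiAt i g := by
  intro T x hx hxg
  refine h hx ?_
  rw [comp_closedComp]
  exact hxg.comp_closed f

lemma EpiAt.of_homotopic {f f' : 𝒜.Closed X Y} (h : EpiAt i f) (hf : Homotopic f f') :
    EpiAt i f' := by
  intro T x hx hxf
  refine h hx ?_
  have := IsCob.cocycle_comp hf hx
  rw [map_sub] at this
  exact this.of_sub_right hxf

lemma EpiAt.neg {f : 𝒜.Closed X Y} (h : EpiAt i f) : EpiAt i (-f) := by
  intro T x hx hxf
  refine h hx ?_
  have := hxf.neg
  rwa [Submodule.coe_neg, map_neg, neg_neg] at this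

lemma MonoAt.closedComp {f : 𝒜.Closed X Y} {g : 𝒜.Closed Y Z} (hf : MonoAt i f)
    (hg : MonoAt i g) : MonoAt i (DGCategory.closedComp g f) := by
  intro T x hx h
  refine hf hx (hg (hx.closed_comp f) ?_)
  have := 𝒜.assoc (add_zero 0) (zero_add i) (zero_add i) (zero_add i) g.1 f.1 x
  rw [← this]
  exact h

lemma epiAt_closedId (X : 𝒜.Obj) : EpiAt i (closedId X) := by
  intro T x hx h
  rwa [closedId, 𝒜.comp_id] at h

/-- `(f, g)` induces exact sequences `Hⁱ(Z, T) → Hⁱ(Y, T) → Hⁱ(X, T)` for `i ≤ 0`. -/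
def Coexact (f : 𝒜.Closed X Y) (g : 𝒜.Closed Y Z) : Prop :=
  ∀ ⦃T : 𝒜.Obj⦄ ⦃i : ℤ⦄, i ≤ 0 → ∀ ⦃y : (𝒜.Hom Y T).X i⦄, IsCocycle y →
    IsCob (𝒜.comp (add_zero i) y f.1) →
    ∃ z : (𝒜.Hom Z T).X i, IsCocycle z ∧ IsCob (𝒜.comp (add_zero i) z g.1 - y)

/-- `(f, g)` induces exact sequences `Hⁱ(T, X) → Hⁱ(T, Y) → Hⁱ(T, Z)` for `i ≤ 0`. -/
def MidExact (f : 𝒜.Closed X Y) (g : 𝒜.Closed Y Z) : Prop :=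
  ∀ ⦃T : 𝒜.Obj⦄ ⦃i : ℤ⦄, i ≤ 0 → ∀ ⦃y : (𝒜.Hom T Y).X i⦄, IsCocycle y →
    IsCob (𝒜.comp (zero_add i) g.1 y) →
    ∃ x : (𝒜.Hom T X).X i, IsCocycle x ∧ IsCob (𝒜.comp (zero_add i) f.1 x - y)

lemma ThreeTerm.IsLeftExact.midExact {c : 𝒜.ThreeTerm} (hc : c.IsLeftExact) :
    MidExact c.f c.g := by
  intro T i hi y hy ⟨z, hz⟩
  exact mappingCocone.exists_of_quasiIsoAt_lift _ (sub_add_cancel i 1) rfl (hc T i hi) y hy z hz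

lemma ThreeTerm.IsRightExact.coexact {c : 𝒜.ThreeTerm} (hc : c.IsRightExact) :
    Coexact c.f c.g := by
  intro T i hi y hy h
  obtain ⟨x, hx, hxy⟩ := ThreeTerm.IsLeftExact.midExact hc (T := T) hi hy
    ((op_comp_zero_left c.f y).symm ▸ h)
  exact ⟨x, hx, op_comp_zero_left c.g x ▸ hxy⟩

/-- The form of exactness needed when the base change argument is run in the opposite category. -/
lemma ThreeTerm.IsLeftExact.coexact_op {c : 𝒜.ThreeTerm} (hc : c.IsLeftExact) :
    Coexact c.op.f c.op.g := by
  intro T i hi y hy h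
  obtain ⟨x, hx, hxy⟩ := hc.midExact (T := T) hi hy (op_comp_zero_right c.g y ▸ h)
  exact ⟨x, hx, (op_comp_zero_right c.f x).symm ▸ hxy⟩

/-- In the long exact sequence the kernel of `Hⁱ(T, X) → Hⁱ(T, Y)` is a quotient of `Hⁱ⁻¹(T, Z)`. -/
lemma ThreeTerm.IsLeftExact.monoAt {c : 𝒜.ThreeTerm} (hc : c.IsLeftExact) (hi : i ≤ 0)
    (hZ : ∀ T, IsZero ((𝒜.Hom T c.Z).homology (i - 1))) : MonoAt i c.f := by
  intro T x hx ⟨y, hy⟩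
  exact mappingCocone.exists_d_eq_of_quasiIsoAt_lift _ (sub_add_cancel (i - 1) 1)
    (sub_add_cancel i 1) rfl (hc T i hi) (hZ T) x hx y hy

/-- If `g ∘ u` is an epimorphism in degree `i`, so is `v ∘ f`, for `(f, g)` coexact and `u`, `v`
the complementary inclusion and projection of a homotopy direct sum decomposition. -/
lemma Coexact.epiAt {P W Y' : 𝒜.Obj} {f : 𝒜.Closed X P} {g : 𝒜.Closed P Z} (hfg : Coexact f g)
    {u : 𝒜.Closed W P} {v : 𝒜.Closed P Y'} {v' : 𝒜.Closed Y' P}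
    (huv : Homotopic (closedComp v u) 0) (hv : Homotopic (closedComp v v') (closedId Y'))
    (hi : i ≤ 0) (h : EpiAt i (closedComp g u)) : EpiAt i (closedComp v f) := by
  intro T y hy hyf
  rw [comp_closedComp] at hyf
  -- As `y ∘ v` dies on `f`, it factors as `z ∘ g` up to homotopy. Restricting along `u` kills `y ∘
  -- v`, hence kills `z ∘ g ∘ u`, hence `z`.
  obtain ⟨z, hz, hzy⟩ := hfg hi (hy.comp_closed v) hyf
  have hzu := hzy.comp_closed u
  rw [map_sub, LinearMap.sub_apply, ← comp_closedComp, ← comp_closedComp] at hzu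
  have hyvu := IsCob.cocycle_comp huv hy
  rw [ZeroMemClass.coe_zero, sub_zero] at hyvu
  have hz' := (h hz (hzu.of_sub_right hyvu)).comp_closed g
  -- Now `y ∘ v` is null, and the section `v'` of `v` recovers `y`.
  have hyv := (hzy.of_sub_left hz').comp_closed v'
  rw [← comp_closedComp] at hyv
  have := IsCob.cocycle_comp hv hy
  rw [map_sub] at this
  have := this.of_sub_left hyv
  rwa [closedId, 𝒜.comp_id] at this

end Cancellation

end DGCategory

namespace DGCategory

variable {k : Type w} [CommRing k] {𝒜 : DGCategory.{w, v, u} k}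

/-! ### Postcomposition cochains -/

section Post

variable {X Y Z : 𝒜.Obj} (T : 𝒜.Obj)

lemma post_sub {m : ℤ} (f g : (𝒜.Hom X Y).X m) : post T (f - g) = post T f - post T g := by
  ext p q hpq x
  simp [post]

lemma post_comp {m₁ m₂ m : ℤ} (hm : m₁ + m₂ = m) (f : (𝒜.Hom X Y).X m₁) (g : (𝒜.Hom Y Z).X m₂) :
    (post T f).comp (post T g) hm = post T (𝒜.comp (by omega : m₂ + m₁ = m) g f) := by
  ext p q hpq x
  rw [Cochain.comp_v _ _ hm p (p + m₁) q rfl (by omega)]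
  exact (𝒜.assoc _ _ _ _ g f x).symm

lemma δ_post_eq_sub {W : 𝒜.Obj} (f : 𝒜.Closed X Y) (a : 𝒜.Closed X W) (b : 𝒜.Closed Y Z)
    (g : 𝒜.Closed W Z) (s : (𝒜.Hom X Z).X (-1))
    (hs : (𝒜.Hom X Z).d (-1) 0 s = 𝒜.comp (add_zero 0) g.1 a.1 - 𝒜.comp (add_zero 0) b.1 f.1) :
    δ (-1) 0 (post T s) = Cochain.ofHom (postHom T a ≫ postHom T g) -
      Cochain.ofHom (postHom T f ≫ postHom T b) := by
  rw [δ_post T (neg_add_cancel 1), hs, ofHom_postHom_comp, ofHom_postHom_comp, post_sub]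

end Post

/-! ### Invariance of exactness under equivalence -/

section Equivalence

/-- Left exactness is invariant under homotopy coherent equivalences. -/
lemma ThreeTerm.isLeftExact_iff {c c' : 𝒜.ThreeTerm} (r₁ : 𝒜.Closed c.X c'.X)
    (r₂ : 𝒜.Closed c.Y c'.Y) (r₃ : 𝒜.Closed c.Z c'.Z) (s₁ : (𝒜.Hom c.X c'.Y).X (-1))
    (s₂ : (𝒜.Hom c.Y c'.Z).X (-1)) (t : (𝒜.Hom c.X c'.Z).X (-2))
    (h₁ : ∀ T i, QuasiIsoAt (postHom T r₁) i) (h₂ : ∀ T i, QuasiIsoAt (postHom T r₂) i)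
    (h₃ : ∀ T i, QuasiIsoAt (postHom T r₃) i)
    (hs₁ : (𝒜.Hom c.X c'.Y).d (-1) 0 s₁ =
      𝒜.comp (add_zero 0) c'.f.1 r₁.1 - 𝒜.comp (add_zero 0) r₂.1 c.f.1)
    (hs₂ : (𝒜.Hom c.Y c'.Z).d (-1) 0 s₂ =
      𝒜.comp (add_zero 0) c'.g.1 r₂.1 - 𝒜.comp (add_zero 0) r₃.1 c.g.1)
    (ht : (𝒜.Hom c.X c'.Z).d (-2) (-1) t =
      𝒜.comp (zero_add (-1)) r₃.1 c.h - 𝒜.comp (add_zero (-1)) s₂ c.f.1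
        - 𝒜.comp (zero_add (-1)) c'.g.1 s₁ - 𝒜.comp (add_zero (-1)) c'.h r₁.1) :
    c.IsLeftExact ↔ c'.IsLeftExact := by
  refine forall_congr' fun T => forall_congr' fun i => imp_congr Iff.rfl ?_
  refine mappingCocone.quasiIsoAt_lift_iff _ _ (postHom T r₂) (postHom T r₃) (post T s₂)
    (δ_post_eq_sub T _ _ _ _ _ hs₂) (postHom T r₁) (post T s₁) (post T t)
    (δ_post_eq_sub T _ _ _ _ _ hs₁) ?_ (h₁ T) (h₂ T) (h₃ T) i
  simp only [ofHom_postHom, post_comp, δ_post T (by norm_num : (-2 : ℤ) + 1 = -1), ht, post_sub]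

lemma op_closedComp {X Y Z : 𝒜.Obj} (f : 𝒜.Closed X Y) (g : 𝒜.Closed Y Z) :
    closedComp f.op g.op = (closedComp g f).op :=
  Subtype.ext (op_comp_zero_left f g.1)

lemma ThreeTerm.Equivalent.isShortExact {c c' : 𝒜.ThreeTerm} (h : c.Equivalent c')
    (hc : c.IsShortExact) : c'.IsShortExact := by
  obtain ⟨r₁, r₂, r₃, s₁, s₂, t, h₁, h₂, h₃, hs₁, hs₂, ht⟩ := h
  obtain ⟨r₁', h₁, h₁'⟩ := exists_homotopy_inverse h₁
  obtain ⟨r₂', h₂, h₂'⟩ := exists_homotopy_inverse h₂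
  obtain ⟨r₃', h₃, h₃'⟩ := exists_homotopy_inverse h₃
  have hop {X Y : 𝒜.Obj} {r : 𝒜.Closed X Y} {r' : 𝒜.Closed Y X}
      (h : Homotopic (closedComp r' r) (closedId X))
      (h' : Homotopic (closedComp r r') (closedId Y)) (T : 𝒜.op.Obj) (i : ℤ) :
      QuasiIsoAt (postHom T r.op) i := by
    refine quasiIsoAt_postHom (𝒜 := 𝒜.op) T (r' := r'.op) ?_ ?_ i
    · rw [op_closedComp]
      exact h'
    · rw [op_closedComp]
      exact h
  refine ⟨(isLeftExact_iff r₁ r₂ r₃ s₁ s₂ t (fun T => quasiIsoAt_postHom T h₁ h₁')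
    (fun T => quasiIsoAt_postHom T h₂ h₂') (fun T => quasiIsoAt_postHom T h₃ h₃')
    hs₁ hs₂ ht).1 hc.1, ?_⟩
  -- Dualizing reverses the equivalence, so it now runs from `c'.op` to `c.op`. The two sides of
  -- each homotopy change places, whence the signs.
  refine (isLeftExact_iff (c := c'.op) (c' := c.op) r₃.op r₂.op r₁.op (-s₂) (-s₁) (-t) (hop h₃ h₃')
    (hop h₂ h₂') (hop h₁ h₁') ?_ ?_ ?_).2 hc.2
  · refine (map_neg ((𝒜.Hom c.Y c'.Z).d (-1) 0).hom s₂).trans ?_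
    refine (congrArg Neg.neg hs₂).trans ((neg_sub _ _).trans (congrArg₂ _ ?_ ?_))
    · exact (op_comp_zero_left c.g r₃.1).symm
    · exact (op_comp_zero_left r₂ c'.g.1).symm
  · refine (map_neg ((𝒜.Hom c.X c'.Y).d (-1) 0).hom s₁).trans ?_
    refine (congrArg Neg.neg hs₁).trans ((neg_sub _ _).trans (congrArg₂ _ ?_ ?_))
    · exact (op_comp_zero_left c.f r₂.1).symm
    · exact (op_comp_zero_left r₁ c'.f.1).symm
  · have e₁ := op_comp_zero_left r₁ c'.h
    have e₂ := op_comp_zero_right c'.g (-s₁)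
    have e₃ := op_comp_zero_left c.f (-s₂)
    have e₄ := op_comp_zero_right r₃ c.h
    refine (map_neg ((𝒜.Hom c.X c'.Z).d (-2) (-1)).hom t).trans ?_
    have E : -(𝒜.comp (zero_add (-1)) r₃.1 c.h - 𝒜.comp (add_zero (-1)) s₂ c.f.1
        - 𝒜.comp (zero_add (-1)) c'.g.1 s₁ - 𝒜.comp (add_zero (-1)) c'.h r₁.1) =
        𝒜.comp (add_zero (-1)) c'.h r₁.1 - 𝒜.comp (zero_add (-1)) c'.g.1 (-s₁)
          - 𝒜.comp (add_zero (-1)) (-s₂) c.f.1 - 𝒜.comp (zero_add (-1)) r₃.1 c.h := by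
      simp only [map_neg, LinearMap.neg_apply]
      abel
    refine (congrArg Neg.neg ht).trans (E.trans ?_)
    exact congrArg₂ _ (congrArg₂ _ (congrArg₂ _ e₁.symm e₂.symm) e₃.symm) e₄.symm

end Equivalence

/-! ### Homotopy biproducts and homotopy cartesian squares -/

section Biproducts

/-- A direct sum decomposition in the homotopy category. -/
structure HomotopyBiprod (X₁ X₂ : 𝒜.Obj) where
  P : 𝒜.Obj
  i₁ : 𝒜.Closed X₁ P
  i₂ : 𝒜.Closed X₂ P
  p₁ : 𝒜.Closed P X₁
  p₂ : 𝒜.Closed P X₂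
  p₁_i₁ : Homotopic (closedComp p₁ i₁) (closedId X₁)
  p₂_i₂ : Homotopic (closedComp p₂ i₂) (closedId X₂)
  p₁_i₂ : Homotopic (closedComp p₁ i₂) 0
  p₂_i₁ : Homotopic (closedComp p₂ i₁) 0
  total : Homotopic (closedComp i₁ p₁ + closedComp i₂ p₂) (closedId P)

variable {X₁ X₂ : 𝒜.Obj}

/-- The decomposition in the opposite DG-category. -/
def HomotopyBiprod.op (B : HomotopyBiprod X₁ X₂) : HomotopyBiprod (𝒜 := 𝒜.op) X₁ X₂ where
  P := B.P
  i₁ := B.p₁.op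
  i₂ := B.p₂.op
  p₁ := B.i₁.op
  p₂ := B.i₂.op
  p₁_i₁ := by rw [op_closedComp]; exact B.p₁_i₁
  p₂_i₂ := by rw [op_closedComp]; exact B.p₂_i₂
  p₁_i₂ := by rw [op_closedComp]; exact B.p₂_i₁
  p₂_i₁ := by rw [op_closedComp]; exact B.p₁_i₂
  total := by rw [op_closedComp, op_closedComp]; exact B.total

lemma IsAdditive.nonempty_homotopyBiprod (h : 𝒜.IsAdditive) (X₁ X₂ : 𝒜.Obj) :
    Nonempty (HomotopyBiprod X₁ X₂) := by
  have : HasFiniteBiproducts (H0 𝒜) := h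
  have : HasBinaryBiproducts (H0 𝒜) := hasBinaryBiproducts_of_finite_biproducts _
  let P : 𝒜.Obj := (toH0 X₁ ⊞ toH0 X₂).as.obj
  obtain ⟨i₁, h₁⟩ := exists_toH0_eq (Y := P) (biprod.inl : toH0 X₁ ⟶ toH0 X₁ ⊞ toH0 X₂)
  obtain ⟨i₂, h₂⟩ := exists_toH0_eq (Y := P) (biprod.inr : toH0 X₂ ⟶ toH0 X₁ ⊞ toH0 X₂)
  obtain ⟨p₁, h₃⟩ := exists_toH0_eq (X := P) (biprod.fst : toH0 X₁ ⊞ toH0 X₂ ⟶ toH0 X₁)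
  obtain ⟨p₂, h₄⟩ := exists_toH0_eq (X := P) (biprod.snd : toH0 X₁ ⊞ toH0 X₂ ⟶ toH0 X₂)
  refine ⟨⟨P, i₁, i₂, p₁, p₂, ?_, ?_, ?_, ?_, ?_⟩⟩ <;> rw [← toH0_eq_iff]
  · rw [toH0_closedComp, toH0_closedId, h₁, h₃]
    exact biprod.inl_fst
  · rw [toH0_closedComp, toH0_closedId, h₂, h₄]
    exact biprod.inr_snd
  · rw [toH0_closedComp, toH0_zero, h₂, h₃]
    exact biprod.inr_fst
  · rw [toH0_closedComp, toH0_zero, h₁, h₄]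
    exact biprod.inl_snd
  · rw [toH0_add, toH0_closedComp, toH0_closedComp, toH0_closedId, h₁, h₂, h₃, h₄]
    exact biprod.total

/-- The biproduct exists only in `H⁰(𝒜)`, so `𝒜(T, P)` is merely quasi-isomorphic to the direct sum
of complexes in the definition of cartesian squares; the inclusions give the inverse on cohomology.
-/
lemma HomotopyBiprod.quasiIsoAt_lift (B : HomotopyBiprod X₁ X₂) (T : 𝒜.Obj) (i : ℤ) :
    QuasiIsoAt (biprod.lift (postHom T B.p₁) (postHom T B.p₂)) i := by
  have h₁₁ := homologyMap_postHom_eq T B.p₁_i₁ i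
  have h₂₂ := homologyMap_postHom_eq T B.p₂_i₂ i
  have h₁₂ := homologyMap_postHom_eq T B.p₁_i₂ i
  have h₂₁ := homologyMap_postHom_eq T B.p₂_i₁ i
  have h := homologyMap_postHom_eq T B.total i
  rw [postHom_closedComp, postHom_closedId] at h₁₁ h₂₂
  rw [postHom_closedComp, postHom_zero] at h₁₂ h₂₁
  rw [postHom_add, postHom_closedComp, postHom_closedComp, postHom_closedId] at h
  rw [quasiIsoAt_iff_isIso_homologyMap]
  refine ⟨HomologicalComplex.homologyMap
    (biprod.desc (postHom T B.i₁) (postHom T B.i₂)) i, ?_, ?_⟩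
  · rw [← HomologicalComplex.homologyMap_comp, biprod.lift_desc, h,
      HomologicalComplex.homologyMap_id]
  -- The composite is expanded as a matrix because its entries are the identity or zero only after
  -- passing to cohomology.
  · have e : biprod.desc (postHom T B.i₁) (postHom T B.i₂) ≫
        biprod.lift (postHom T B.p₁) (postHom T B.p₂) =
        biprod.fst ≫ (postHom T B.i₁ ≫ postHom T B.p₁) ≫ biprod.inl +
        biprod.fst ≫ (postHom T B.i₁ ≫ postHom T B.p₂) ≫ biprod.inr +
        (biprod.snd ≫ (postHom T B.i₂ ≫ postHom T B.p₁) ≫ biprod.inl +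
        biprod.snd ≫ (postHom T B.i₂ ≫ postHom T B.p₂) ≫ biprod.inr) := by
      apply biprod.hom_ext' <;> apply biprod.hom_ext <;> simp
    rw [← HomologicalComplex.homologyMap_comp, e, ← HomologicalComplex.homologyMap_id,
      ← biprod.total]
    simp only [HomologicalComplex.homologyMap_add,
      HomologicalComplex.homologyMap_comp _ (_ ≫ _), HomologicalComplex.homologyMap_comp (_ ≫ _),
      h₁₁, h₁₂, h₂₁, h₂₂]
    simp [HomologicalComplex.homologyMap_comp]

/-- A homotopy commutative square is homotopy cartesian if and only if the corresponding sequence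
`X ⟶ Y ⊞ X' ⟶ Y'` is left exact. -/
lemma Square.isCartesian_iff (q : 𝒜.Square) (B : HomotopyBiprod q.Y q.X') (F : 𝒜.Closed q.X B.P)
    (σ₁ : (𝒜.Hom q.X q.Y).X (-1)) (σ₂ : (𝒜.Hom q.X q.X').X (-1))
    (h₁ : (𝒜.Hom q.X q.Y).d (-1) 0 σ₁ = q.f.1 - (closedComp B.p₁ F).1)
    (h₂ : (𝒜.Hom q.X q.X').d (-1) 0 σ₂ = q.a.1 - (closedComp B.p₂ F).1)
    (h : (𝒜.Hom q.X q.Y').X (-1))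
    (hh : h = q.s + 𝒜.comp (zero_add (-1)) q.b.1 σ₁ - 𝒜.comp (zero_add (-1)) q.f'.1 σ₂)
    (d_h : (𝒜.Hom q.X q.Y').d (-1) 0 h =
      -𝒜.comp (add_zero 0) (closedComp q.b B.p₁ - closedComp q.f' B.p₂).1 F.1) :
    q.IsCartesian ↔
      (ThreeTerm.mk F (closedComp q.b B.p₁ - closedComp q.f' B.p₂) h d_h).IsLeftExact := by
  refine forall_congr' fun T => forall_congr' fun i => imp_congr Iff.rfl ?_
  -- The square formed by the maps to `Y'` commutes strictly, so its homotopy is `0`. The first maps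
  -- agree up to `(σ₁, σ₂)`, and `h` was chosen to differ from `s` by the resulting correction, so
  -- the secondary homotopy is `0` too.
  refine (mappingCocone.quasiIsoAt_lift_iff _ _
    (biprod.lift (postHom T B.p₁) (postHom T B.p₂)) (𝟙 _) 0 ?_ (𝟙 _)
    ((post T σ₁).comp (Cochain.ofHom biprod.inl) (add_zero _) +
      (post T σ₂).comp (Cochain.ofHom biprod.inr) (add_zero _)) 0 ?_ ?_
    (fun i => inferInstance) (B.quasiIsoAt_lift T) (fun i => inferInstance) i).symm
  · rw [δ_zero, biprod.lift_desc, Category.comp_id, postHom_sub, postHom_closedComp,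
      postHom_closedComp, Preadditive.comp_neg, ← sub_eq_add_neg, sub_self]
  · have e (f f' : 𝒜.Closed q.X q.Y) : post T (f.1 - f'.1) =
        Cochain.ofHom (postHom T f) - Cochain.ofHom (postHom T f') := by
      rw [post_sub, ofHom_postHom, ofHom_postHom]
    have e' (f f' : 𝒜.Closed q.X q.X') : post T (f.1 - f'.1) =
        Cochain.ofHom (postHom T f) - Cochain.ofHom (postHom T f') := by
      rw [post_sub, ofHom_postHom, ofHom_postHom]
    rw [δ_add, δ_comp_ofHom, δ_comp_ofHom, δ_post T (neg_add_cancel 1),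
      δ_post T (neg_add_cancel 1), h₁, h₂, e, e', biprod.lift_eq, biprod.lift_eq]
    simp only [postHom_closedComp, Cochain.sub_comp, ← Cochain.ofHom_comp, Cochain.ofHom_add,
      Preadditive.comp_add, Category.id_comp, Category.assoc]
    abel
  · simp only [δ_zero, Cochain.add_comp, Cochain.comp_assoc_of_third_is_zero_cochain,
      ← Cochain.ofHom_comp, biprod.inl_desc, biprod.inr_desc, Cochain.ofHom_neg, Cochain.comp_neg,
      ofHom_postHom, post_comp, Cochain.comp_id, Cochain.id_comp, Cochain.comp_zero, hh]
    ext p r hpr x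
    simp [post]
    abel

lemma closedComp_sub_closedComp {W X Y X' Y' : 𝒜.Obj} (b : 𝒜.Closed Y Y') (f' : 𝒜.Closed X' Y')
    (p₁ : 𝒜.Closed X Y) (p₂ : 𝒜.Closed X X') (F : 𝒜.Closed W X) :
    𝒜.comp (add_zero 0) (closedComp b p₁ - closedComp f' p₂).1 F.1 =
      𝒜.comp (add_zero 0) b.1 (closedComp p₁ F).1 -
        𝒜.comp (add_zero 0) f'.1 (closedComp p₂ F).1 := by
  refine (LinearMap.congr_fun (map_sub (𝒜.comp (add_zero 0)) (closedComp b p₁).1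
    (closedComp f' p₂).1) F.1).trans ?_
  exact congrArg₂ _ (𝒜.assoc _ _ _ _ b.1 p₁.1 F.1) (𝒜.assoc _ _ _ _ f'.1 p₂.1 F.1)

/-- Homotopy pullbacks exist in preabelian DG-categories. -/
lemma exists_isCartesian
    (hker : ∀ {Y Z : 𝒜.Obj} (g : 𝒜.Closed Y Z), ∃ (X : 𝒜.Obj) (f : 𝒜.Closed X Y)
      (h : (𝒜.Hom X Z).X (-1))
      (d_h : (𝒜.Hom X Z).d (-1) 0 h = -𝒜.comp (add_zero 0) g.1 f.1),
      (ThreeTerm.mk f g h d_h).IsLeftExact)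
    {Y X' Y' : 𝒜.Obj} (B : HomotopyBiprod Y X') (b : 𝒜.Closed Y Y') (f' : 𝒜.Closed X' Y') :
    ∃ (X : 𝒜.Obj) (f : 𝒜.Closed X Y) (a : 𝒜.Closed X X') (s : (𝒜.Hom X Y').X (-1))
      (d_s : (𝒜.Hom X Y').d (-1) 0 s =
        𝒜.comp (add_zero 0) f'.1 a.1 - 𝒜.comp (add_zero 0) b.1 f.1),
      (Square.mk f a b f' s d_s).IsCartesian := by
  obtain ⟨X, F, h, d_h, hF⟩ := hker (closedComp b B.p₁ - closedComp f' B.p₂)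
  have d_s : (𝒜.Hom X Y').d (-1) 0 h =
      𝒜.comp (add_zero 0) f'.1 (closedComp B.p₂ F).1 -
        𝒜.comp (add_zero 0) b.1 (closedComp B.p₁ F).1 := by
    rw [d_h, closedComp_sub_closedComp, neg_sub]
  let q : 𝒜.Square := ⟨closedComp B.p₁ F, closedComp B.p₂ F, b, f', h, d_s⟩
  have hh : h = q.s + 𝒜.comp (zero_add (-1)) q.b.1 (0 : (𝒜.Hom q.X q.Y).X (-1)) -
      𝒜.comp (zero_add (-1)) q.f'.1 (0 : (𝒜.Hom q.X q.X').X (-1)) := by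
    rw [map_zero, map_zero, add_zero, sub_zero]
  exact ⟨X, closedComp B.p₁ F, closedComp B.p₂ F, h, d_s, (q.isCartesian_iff B F 0 0
    ((map_zero _).trans (sub_self _).symm) ((map_zero _).trans (sub_self _).symm) h hh d_h).2 hF⟩

lemma HomotopyBiprod.homotopic_p₁ (B : HomotopyBiprod X₁ X₂) {X : 𝒜.Obj} (f : 𝒜.Closed X X₁)
    (a : 𝒜.Closed X X₂) :
    Homotopic (closedComp B.p₁ (closedComp B.i₁ f + closedComp B.i₂ a)) f := by
  have h₁ := (toH0_eq_iff _ _).2 B.p₁_i₁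
  have h₂ := (toH0_eq_iff _ _).2 B.p₁_i₂
  rw [toH0_closedComp, toH0_closedId] at h₁
  rw [toH0_closedComp, toH0_zero] at h₂
  rw [← toH0_eq_iff, toH0_closedComp, toH0_add, toH0_closedComp, toH0_closedComp,
    Preadditive.add_comp, Category.assoc, Category.assoc, h₁, h₂, comp_zero, add_zero,
    Category.comp_id]

lemma HomotopyBiprod.homotopic_p₂ (B : HomotopyBiprod X₁ X₂) {X : 𝒜.Obj} (f : 𝒜.Closed X X₁)
    (a : 𝒜.Closed X X₂) :
    Homotopic (closedComp B.p₂ (closedComp B.i₁ f + closedComp B.i₂ a)) a := by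
  have h₁ := (toH0_eq_iff _ _).2 B.p₂_i₁
  have h₂ := (toH0_eq_iff _ _).2 B.p₂_i₂
  rw [toH0_closedComp, toH0_closedId] at h₂
  rw [toH0_closedComp, toH0_zero] at h₁
  rw [← toH0_eq_iff, toH0_closedComp, toH0_add, toH0_closedComp, toH0_closedComp,
    Preadditive.add_comp, Category.assoc, Category.assoc, h₁, h₂, comp_zero, zero_add,
    Category.comp_id]

lemma HomotopyBiprod.homotopic_i₁ (B : HomotopyBiprod X₁ X₂) {Z : 𝒜.Obj} (b : 𝒜.Closed X₁ Z)
    (f' : 𝒜.Closed X₂ Z) :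
    Homotopic (closedComp (closedComp b B.p₁ - closedComp f' B.p₂) B.i₁) b := by
  have h₁ := (toH0_eq_iff _ _).2 B.p₁_i₁
  have h₂ := (toH0_eq_iff _ _).2 B.p₂_i₁
  rw [toH0_closedComp, toH0_closedId] at h₁
  rw [toH0_closedComp, toH0_zero] at h₂
  rw [← toH0_eq_iff, toH0_closedComp, toH0_sub, toH0_closedComp, toH0_closedComp,
    Preadditive.comp_sub, ← Category.assoc, ← Category.assoc, h₁, h₂, zero_comp, sub_zero,
    Category.id_comp]

lemma HomotopyBiprod.homotopic_i₂ (B : HomotopyBiprod X₁ X₂) {Z : 𝒜.Obj} (b : 𝒜.Closed X₁ Z)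
    (f' : 𝒜.Closed X₂ Z) :
    Homotopic (closedComp (closedComp b B.p₁ - closedComp f' B.p₂) B.i₂) (-f') := by
  have h₁ := (toH0_eq_iff _ _).2 B.p₁_i₂
  have h₂ := (toH0_eq_iff _ _).2 B.p₂_i₂
  rw [toH0_closedComp, toH0_closedId] at h₂
  rw [toH0_closedComp, toH0_zero] at h₁
  rw [← toH0_eq_iff, toH0_closedComp, toH0_sub, toH0_closedComp, toH0_closedComp,
    Preadditive.comp_sub, ← Category.assoc, ← Category.assoc, h₁, h₂, zero_comp, zero_sub,
    Category.id_comp]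
  rfl

/-- The left exact sequence `X ⟶ Y ⊞ X' ⟶ Y'` of a homotopy cartesian square. -/
lemma Square.IsCartesian.exists_isLeftExact {q : 𝒜.Square} (hq : q.IsCartesian)
    (B : HomotopyBiprod q.Y q.X') : ∃ (h : (𝒜.Hom q.X q.Y').X (-1))
    (d_h : (𝒜.Hom q.X q.Y').d (-1) 0 h =
      -𝒜.comp (add_zero 0) (closedComp q.b B.p₁ - closedComp q.f' B.p₂).1
        (closedComp B.i₁ q.f + closedComp B.i₂ q.a).1),
    (ThreeTerm.mk (closedComp B.i₁ q.f + closedComp B.i₂ q.a)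
      (closedComp q.b B.p₁ - closedComp q.f' B.p₂) h d_h).IsLeftExact := by
  obtain ⟨σ₁, h₁⟩ := (isCob_iff (neg_add_cancel 1) _).1 (B.homotopic_p₁ q.f q.a).symm
  obtain ⟨σ₂, h₂⟩ := (isCob_iff (neg_add_cancel 1) _).1 (B.homotopic_p₂ q.f q.a).symm
  have d_h : (𝒜.Hom q.X q.Y').d (-1) 0
      (q.s + 𝒜.comp (zero_add (-1)) q.b.1 σ₁ - 𝒜.comp (zero_add (-1)) q.f'.1 σ₂) =
      -𝒜.comp (add_zero 0) (closedComp q.b B.p₁ - closedComp q.f' B.p₂).1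
        (closedComp B.i₁ q.f + closedComp B.i₂ q.a).1 := by
    rw [map_sub, map_add, d_closed_comp, d_closed_comp, h₁, h₂, q.d_s, closedComp_sub_closedComp,
      map_sub, map_sub]
    abel
  exact ⟨_, d_h, (q.isCartesian_iff B _ σ₁ σ₂ h₁ h₂ _ rfl d_h).1 hq⟩

/-- In a homotopy cartesian square, epimorphisms are stable under base change provided that the
left exact sequences ending with an epimorphism are right exact. -/
lemma Square.IsCartesian.epiAt {q : 𝒜.Square} (hq : q.IsCartesian)
    (B : HomotopyBiprod q.Y q.X') {i : ℤ} (hi : i ≤ 0)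
    (H : ∀ c : 𝒜.ThreeTerm, c.IsLeftExact → EpiAt i c.g → Coexact c.f c.g) :
    (EpiAt i q.b → EpiAt i q.a) ∧ (EpiAt i q.f' → EpiAt i q.f) := by
  obtain ⟨h, d_h, hc⟩ := hq.exists_isLeftExact B
  constructor
  · intro hb
    -- Up to homotopy `b` is the restriction of `Y ⊞ X' ⟶ Y'` to `Y`, so that map is an epimorphism
    -- in degree `i` as well, and `H` applies to the sequence.
    have hg := hb.of_homotopic (B.homotopic_i₁ q.b q.f').symm
    exact ((H _ hc hg.of_closedComp).epiAt B.p₂_i₁ B.p₂_i₂ hi hg).of_homotopic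
      (B.homotopic_p₂ q.f q.a)
  · intro hf
    have hg := hf.neg.of_homotopic (B.homotopic_i₂ q.b q.f').symm
    exact ((H _ hc hg.of_closedComp).epiAt B.p₁_i₂ B.p₁_i₁ hi hg).of_homotopic
      (B.homotopic_p₁ q.f q.a)

end Biproducts

/-! ### `n`-monomorphisms and `n`-epimorphisms in truncated DG-categories -/

section Truncated

variable {n : ℕ∞}

lemma IsTruncated.isNMono_iff (h : 𝒜.IsTruncated n) {X Y : 𝒜.Obj} (f : 𝒜.Closed X Y) :
    IsNMono n f ↔ ∀ m : ℕ, (m : ℕ∞) = n → MonoAt (1 - (m : ℤ)) f := by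
  refine forall_congr' fun m => forall_congr' fun hm => forall_congr' fun T => ?_
  rw [mono_homologyMap_iff _ (sub_add_cancel _ 1) rfl]
  -- Truncation makes both cohomology modules zero in these degrees, so only injectivity in degree
  -- `1 - m` remains.
  have hiso (i : ℤ) (hi : i ≤ -(m : ℤ)) :
      IsIso (HomologicalComplex.homologyMap (postHom T f) i) := by
    obtain ⟨l, rfl⟩ : ∃ l : ℕ, i = -(l : ℤ) := ⟨(-i).toNat, by omega⟩
    have hl : n ≤ l := by
      rw [← hm]
      exact_mod_cast (by omega : m ≤ l)
    have hX := h.2 T X l hl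
    have hY := h.2 T Y l hl
    exact ⟨hY.to_ _, hX.eq_of_src _ _, hY.eq_of_src _ _⟩
  exact ⟨fun H x hx ⟨y, hy⟩ => H.1 x hx y hy, fun H => ⟨fun x hx y hy => H hx ⟨y, hy⟩, hiso⟩⟩

lemma IsTruncated.op (h : 𝒜.IsTruncated n) : 𝒜.op.IsTruncated n :=
  ⟨fun X Y => h.1 Y X, fun X Y => h.2 Y X⟩

lemma IsTruncated.isNEpi_iff (h : 𝒜.IsTruncated n) {X Y : 𝒜.Obj} (f : 𝒜.Closed X Y) :
    IsNEpi n f ↔ ∀ m : ℕ, (m : ℕ∞) = n → EpiAt (1 - (m : ℤ)) f :=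
  (h.op.isNMono_iff f.op).trans
    (forall_congr' fun _ => imp_congr Iff.rfl (monoAt_op_iff f))

lemma IsTruncated.isNMono (hn : 1 ≤ n) (h : 𝒜.IsTruncated n) {c : 𝒜.ThreeTerm}
    (hc : c.IsLeftExact) : IsNMono n c.f := by
  rw [h.isNMono_iff]
  rintro m rfl
  have hm : 1 ≤ m := by exact_mod_cast hn
  -- Left exactness gives information only in degrees `≤ 0`; `1 ≤ m` ensures that `1 - m` is one of
  -- them.
  refine hc.monoAt (by omega) fun T => ?_
  rw [show (1 - (m : ℤ)) - 1 = -m by ring]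
  exact h.2 T c.Z m le_rfl

lemma IsTruncated.isNEpi (hn : 1 ≤ n) (h : 𝒜.IsTruncated n) {c : 𝒜.ThreeTerm}
    (hc : c.IsRightExact) : IsNEpi n c.g :=
  h.op.isNMono hn (c := c.op) hc

end Truncated

/-- A 3-term homotopy complex of the opposite DG-category, viewed in the original one. -/
def ThreeTerm.unop (c : 𝒜.op.ThreeTerm) : 𝒜.ThreeTerm where
  f := c.g
  g := c.f
  h := c.h
  d_h := c.d_h.trans (congrArg Neg.neg (op_comp_zero_left (𝒜 := 𝒜) c.g c.f.1))

/-! ### The exact structure on an abelian truncated DG-category -/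

namespace IsAbelianTruncated

variable {n : ℕ∞} (h𝒜 : 𝒜.IsAbelianTruncated n)

include h𝒜

lemma isInflation_iff (hn : 1 ≤ n) {X Y : 𝒜.Obj} (f : 𝒜.Closed X Y) :
    IsInflation {c : 𝒜.ThreeTerm | c.IsShortExact} f ↔ IsNMono n f := by
  constructor
  · rintro ⟨Z, g, h, d_h, hc⟩
    exact h𝒜.truncated.isNMono hn hc.1
  · intro hf
    obtain ⟨Z, g, h, d_h, hc⟩ := h𝒜.preabelian.exists_cokernel f
    exact ⟨Z, g, h, d_h, h𝒜.shortExact_of_nMono _ hc hf⟩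

lemma isDeflation_iff (hn : 1 ≤ n) {X Y : 𝒜.Obj} (f : 𝒜.Closed X Y) :
    IsDeflation {c : 𝒜.ThreeTerm | c.IsShortExact} f ↔ IsNEpi n f := by
  constructor
  · rintro ⟨Z, g, h, d_h, hc⟩
    exact h𝒜.truncated.isNEpi hn hc.2
  · intro hf
    obtain ⟨Z, g, h, d_h, hc⟩ := h𝒜.preabelian.exists_kernel f
    exact ⟨Z, g, h, d_h, h𝒜.shortExact_of_nEpi _ hc hf⟩

/-- The abelian axiom enters here: it upgrades a left exact sequence ending in an `n`-epimorphism to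
a right exact one, as required by `Square.IsCartesian.epiAt`. -/
lemma isNEpi_of_isCartesian (hn : 1 ≤ n) {q : 𝒜.Square} (hq : q.IsCartesian)
    (hf : IsNEpi n q.f') : IsNEpi n q.f := by
  obtain ⟨B⟩ := h𝒜.preabelian.additive.nonempty_homotopyBiprod q.Y q.X'
  rw [h𝒜.truncated.isNEpi_iff] at hf ⊢
  rintro m rfl
  have hm : 1 ≤ m := by exact_mod_cast hn
  refine (hq.epiAt B (by omega) fun c hc hg => ?_).2 (hf m rfl)
  refine (h𝒜.shortExact_of_nEpi c hc ?_).2.coexact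
  rw [h𝒜.truncated.isNEpi_iff]
  intro l hl
  obtain rfl : l = m := by exact_mod_cast hl
  exact hg

lemma isNMono_of_isCocartesian (hn : 1 ≤ n) {q : 𝒜.Square} (hq : q.IsCocartesian)
    (hf : IsNMono n q.f) : IsNMono n q.f' := by
  obtain ⟨B⟩ := h𝒜.preabelian.additive.nonempty_homotopyBiprod q.Y q.X'
  rw [h𝒜.truncated.isNMono_iff] at hf ⊢
  rintro m rfl
  have hm : 1 ≤ m := by exact_mod_cast hn
  -- Dualizing reflects the square so that `f` and `f'` become its vertical sides `b` and `a`; hence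
  -- the first half of `epiAt` is used here, and the second half for pullbacks.
  refine (epiAt_op_iff q.f').1 ((Square.IsCartesian.epiAt (q := q.op) hq B.op (by omega)
    fun c hc hg => ?_).1 ((epiAt_op_iff q.f).2 (hf m rfl)))
  refine (h𝒜.shortExact_of_nMono c.unop hc ?_).1.coexact_op
  rw [h𝒜.truncated.isNMono_iff]
  intro l hl
  obtain rfl : l = m := by exact_mod_cast hl
  exact (epiAt_op_iff c.unop.f).1 hg

lemma isNEpi_closedComp {X Y Z : 𝒜.Obj} {f : 𝒜.Closed X Y} {g : 𝒜.Closed Y Z} (hf : IsNEpi n f)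
    (hg : IsNEpi n g) : IsNEpi n (closedComp g f) := by
  rw [h𝒜.truncated.isNEpi_iff] at *
  exact fun m hm => (hf m hm).closedComp (hg m hm)

lemma isNMono_closedComp {X Y Z : 𝒜.Obj} {f : 𝒜.Closed X Y} {g : 𝒜.Closed Y Z}
    (hf : IsNMono n f) (hg : IsNMono n g) : IsNMono n (closedComp g f) := by
  rw [h𝒜.truncated.isNMono_iff] at *
  exact fun m hm => (hf m hm).closedComp (hg m hm)

lemma isNEpi_closedId (X : 𝒜.Obj) : IsNEpi n (closedId X) := by
  rw [h𝒜.truncated.isNEpi_iff]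
  exact fun m hm => epiAt_closedId X

/-- The homotopy short exact sequences of an abelian truncated DG-category are the conflations of
an exact structure. -/
lemma isExact (hn : 1 ≤ n) : 𝒜.IsExact {c : 𝒜.ThreeTerm | c.IsShortExact} where
  additive := h𝒜.preabelian.additive
  shortExact _ hc := hc
  mem_of_equivalent _ _ h hc := h.isShortExact hc
  ex0 O _ := (h𝒜.isDeflation_iff hn _).2 (h𝒜.isNEpi_closedId O)
  ex1 f g hf hg := by
    rw [h𝒜.isDeflation_iff hn] at *
    exact h𝒜.isNEpi_closedComp hf hg
  ex1' f g hf hg := by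
    rw [h𝒜.isInflation_iff hn] at *
    exact h𝒜.isNMono_closedComp hf hg
  ex2 {B C C'} p c _ := by
    obtain ⟨D⟩ := h𝒜.preabelian.additive.nonempty_homotopyBiprod C' B
    exact exists_isCartesian h𝒜.preabelian.exists_kernel D c p
  ex2_stable q hq hf := by
    rw [h𝒜.isDeflation_iff hn] at *
    exact h𝒜.isNEpi_of_isCartesian hn hq hf
  ex2' {A A' B} i a _ := by
    obtain ⟨D⟩ := h𝒜.preabelian.additive.nonempty_homotopyBiprod B A'
    -- Homotopy cokernels are homotopy kernels in the opposite category, so pushouts are obtained as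
    -- pullbacks there.
    obtain ⟨B', b, i', s, d_s, h⟩ := exists_isCartesian (𝒜 := 𝒜.op) (fun g => by
      obtain ⟨Z, f, h, d_h, hc⟩ := h𝒜.preabelian.exists_cokernel (𝒜 := 𝒜) g
      exact ⟨Z, f, h, (ThreeTerm.mk (𝒜 := 𝒜) g f h d_h).op.d_h, hc⟩) D.op i.op a.op
    refine ⟨B', i', b, s, d_s.trans (congrArg₂ _ ?_ ?_), h⟩
    · exact op_comp_zero_left a i'.1
    · exact op_comp_zero_left i b.1
  ex2'_stable q hq hf := by
    rw [h𝒜.isInflation_iff hn] at *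
    exact h𝒜.isNMono_of_isCocartesian hn hq hf

end IsAbelianTruncated

end DGCategory

theorem mainTheorem4 {k : Type w} [CommRing k] (𝒜 : DGCategory.{w, v, u} k) (n : ℕ∞) (hn : 1 ≤ n)
    (h𝒜 : 𝒜.IsAbelianTruncated n) :
    𝒜.IsExact {c : 𝒜.ThreeTerm | c.IsShortExact} ∧
    (∀ (X Y : 𝒜.Obj) (f : 𝒜.Closed X Y),
      DGCategory.IsInflation {c : 𝒜.ThreeTerm | c.IsShortExact} f ↔ DGCategory.IsNMono n f) ∧
    (∀ (X Y : 𝒜.Obj) (f : 𝒜.Closed X Y),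
      DGCategory.IsDeflation {c : 𝒜.ThreeTerm | c.IsShortExact} f ↔ DGCategory.IsNEpi n f) :=
  ⟨h𝒜.isExact hn, fun _ _ f => h𝒜.isInflation_iff hn f, fun _ _ f => h𝒜.isDeflation_iff hn f⟩
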